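/- Let $N,M\ge 1$ and let $\Omega\subset\mathbb R^N$ be a bounded, connected, nonempty open set. For $F=\mathbb R$ or $F=\mathbb R^M$ let $H^1_0(\Omega,F)$ be the closure of $C_c^\infty(\Omega,F)$ in $H^1(\Omega,F)$, and let the Dirichlet Laplacian on $L^2(\Omega,F)$ be the operator defined as follows: $u$ belongs to its domain and is mapped to $f\in L^2(\Omega,F)$ iff $u\in H^1_0(\Omega,F)$ and $$\sum_{j=1}^N\int_\Omega\langle\partial_j u,\partial_j v\rangle\,dx=\int_\Omega\langle f,v\rangle\,dx\qquad\text{for all }v\in H_0^1(\Omega,F).$$ Let $\lambda_1$ be the first (smallest) eigenvalue of the Dirichlet Laplacian on $L^2(\Omega,\mathbb R)$. Let $E=L^2(\Omega,\mathbb R^M)$, let $A\colon E\supset D(A)\to E$ be the Dirichlet Laplacian on $E$, and let $K=\{u\in E\mid u_i(x)\ge 0\text{ for a.a. }x\in\Omega,\ i=1,\dots,M\}$. Let $D=[d_{ij}]$ be a real $M\times M$ matrix that is quasi-nonnegative, i.e., $d_{ij}\ge 0$ for $i\ne j$, and let $G\colon E\to E$, $G(u)(x)=Du(x)$. Put $$\sigma_+(D)=\{\lambda\in\mathbb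 R\mid Dv=\lambda v\text{ for some }0\ne v\in\mathbb R^M_+\},\qquad s(D)=\max\operatorname{Re}\sigma(D),$$ where $\mathbb R^M_+=[0,\infty)^M$ and $\sigma(D)$ is the complex spectrum of $D$. If $\lambda_1\notin\sigma_+(D)$, then $\ker(A-G)\cap K=\{0\}$, that is, $u=0$ is the only $u\in D(A)\cap K$ with $Au=G(u)$. If, additionally, $s(D)>\lambda_1$, then there is $\bar u\in K$ such that $(A-G)^{-1}(\bar u)\cap K=\emptyset$, that is, no $u\in D(A)\cap K$ satisfies $Au-G(u)=\bar u$. -/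

import Mathlib

open MeasureTheory TopologicalSpace
open scoped Distributions LineDeriv ContDiff

namespace DirichletSystem

noncomputable section

/-- The Euclidean space `ℝ^N`. -/
abbrev Space (N : ℕ) : Type := EuclideanSpace ℝ (Fin N)

/-- The space `L²(Ω, F)` with respect to Lebesgue measure on `Ω`. -/
abbrev L2 {N : ℕ} (Ω : Opens (Space N)) (F : Type*) [NormedAddCommGroup F] :=
  Lp F 2 (volume.restrict (Ω : Set (Space N)))

section Sobolev

variable {N : ℕ} (Ω : Opens (Space N))
  (F : Type*) [NormedAddCommGroup F] [InnerProductSpace ℝ F]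

/-- The `j`-th standard basis vector of `ℝ^N`. -/
def basisVec (j : Fin N) : Space N := EuclideanSpace.single j 1

theorem testFunction_memLp (ψ : 𝓓(Ω, F)) :
    MemLp ψ 2 (volume.restrict (Ω : Set (Space N))) :=
  ψ.continuous.memLp_of_hasCompactSupport ψ.hasCompactSupport

/-- The inclusion `C_c^∞(Ω, F) → L²(Ω, F)`. -/
def testToL2 : 𝓓(Ω, F) →ₗ[ℝ] L2 Ω F where
  toFun ψ := (testFunction_memLp Ω F ψ).toLp ψ
  map_add' _ _ := rfl
  map_smul' _ _ := rfl

/-- `g` is the `j`-th weak partial derivative of `u` on `Ω`: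
`∫_Ω (∂_j η) u = - ∫_Ω η g` for every `η ∈ C_c^∞(Ω)`. -/
def IsWeakPartialDeriv {Ω : Opens (Space N)} {F : Type*} [NormedAddCommGroup F]
    [InnerProductSpace ℝ F] (j : Fin N) (u g : L2 Ω F) : Prop :=
  ∀ η : 𝓓(Ω, ℝ),
    ∫ x in (Ω : Set (Space N)), (lineDeriv ℝ η x (basisVec j)) • u x =
      - ∫ x in (Ω : Set (Space N)), η x • g x

theorem integrable_testFunction_smul (η : 𝓓(Ω, ℝ)) (u : L2 Ω F) :
    Integrable (fun x => η x • u x) (volume.restrict (Ω : Set (Space N))) :=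
  memLp_one_iff_integrable.1
    ((Lp.memLp u).smul (p := 2) (q := 2) (r := 1) (testFunction_memLp Ω ℝ η))

theorem lineDeriv_testFunction (ψ : 𝓓(Ω, F)) (j : Fin N) (x : Space N) :
    lineDeriv ℝ ψ x (basisVec j) = (TestFunction.lineDerivCLM ℝ (basisVec j) ψ : 𝓓(Ω, F)) x :=
  (TestFunction.lineDerivCLM_apply_of_le (by simp)).symm

/-- The Sobolev space `H¹(Ω, F)`, each element `u` being recorded together with its weak gradient,
as the pair `(u, (∂_1 u, …, ∂_N u))`. The topology of `L² × (L²)^N` restricts to the topology of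
the `H¹` norm. -/
def H1 : Submodule ℝ (L2 Ω F × (Fin N → L2 Ω F)) where
  carrier := {p | ∀ j, IsWeakPartialDeriv j p.1 (p.2 j)}
  zero_mem' := by
    intro j η
    have h0 : ∀ᵐ x ∂(volume.restrict (Ω : Set (Space N))), (0 : L2 Ω F) x = 0 :=
      Lp.coeFn_zero F 2 _
    rw [integral_eq_zero_of_ae, integral_eq_zero_of_ae, neg_zero]
    · filter_upwards [h0] with x hx
      change _ • (0 : L2 Ω F) x = 0
      rw [hx, smul_zero]
    · filter_upwards [h0] with x hx
      change _ • (0 : L2 Ω F) x = 0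
      rw [hx, smul_zero]
  add_mem' := by
    intro p q hp hq j η
    have h1 := Lp.coeFn_add p.1 q.1
    have h2 := Lp.coeFn_add (p.2 j) (q.2 j)
    have e1 := hp j η
    have e2 := hq j η
    simp only [lineDeriv_testFunction] at e1 e2 ⊢
    rw [integral_congr_ae (g := fun x =>
        (TestFunction.lineDerivCLM ℝ (basisVec j) η : 𝓓(Ω, ℝ)) x • p.1 x
          + (TestFunction.lineDerivCLM ℝ (basisVec j) η : 𝓓(Ω, ℝ)) x • q.1 x),
      integral_congr_ae (f := fun x => η x • (p + q).2 j x)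
        (g := fun x => η x • p.2 j x + η x • q.2 j x),
      integral_add (integrable_testFunction_smul Ω F _ _) (integrable_testFunction_smul Ω F _ _),
      integral_add (integrable_testFunction_smul Ω F _ _) (integrable_testFunction_smul Ω F _ _),
      e1, e2, neg_add]
    · filter_upwards [h2] with x hx
      simp only [Prod.snd_add, Pi.add_apply] at hx ⊢
      rw [hx, smul_add]
    · filter_upwards [h1] with x hx
      simp only [Prod.fst_add, Pi.add_apply] at hx ⊢
      rw [hx, smul_add]
  smul_mem' := by
    intro c p hp j η
    have h1 := Lp.coeFn_smul c p.1
    have h2 := Lp.coeFn_smul c (p.2 j)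
    have e1 := hp j η
    rw [integral_congr_ae (g := fun x => c • (lineDeriv ℝ η x (basisVec j) • p.1 x)),
      integral_congr_ae (f := fun x => η x • (c • p).2 j x) (g := fun x => c • (η x • p.2 j x)),
      integral_smul, integral_smul, e1, smul_neg]
    · filter_upwards [h2] with x hx
      simp only [Prod.smul_snd, Pi.smul_apply] at hx ⊢
      rw [hx, smul_comm]
    · filter_upwards [h1] with x hx
      simp only [Prod.smul_fst, Pi.smul_apply] at hx ⊢
      rw [hx, smul_comm]

/-- The map `ψ ↦ (ψ, (∂_1 ψ, …, ∂_N ψ))` on `C_c^∞(Ω, F)`. -/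
def testWithGradient : 𝓓(Ω, F) →ₗ[ℝ] L2 Ω F × (Fin N → L2 Ω F) :=
  (testToL2 Ω F).prod (LinearMap.pi fun j =>
    testToL2 Ω F ∘ₗ (TestFunction.lineDerivCLM ℝ (basisVec j) : 𝓓(Ω, F) →L[ℝ] 𝓓(Ω, F)).toLinearMap)

/-- The space `H¹₀(Ω, F)`: the closure of `C_c^∞(Ω, F)` in `H¹(Ω, F)`. -/
def H10 : Submodule ℝ (L2 Ω F × (Fin N → L2 Ω F)) :=
  H1 Ω F ⊓ (LinearMap.range (testWithGradient Ω F)).topologicalClosure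

/-- The graph of the Dirichlet realization of `-Δ` in `L²(Ω, F)`: `(u, f)` belongs to it iff
`u ∈ H¹₀(Ω, F)` and `∑_j ⟨∂_j u, ∂_j v⟩ = ⟨f, v⟩` in `L²(Ω, F)` for every `v ∈ H¹₀(Ω, F)`. -/
def laplacianGraph : Submodule ℝ (L2 Ω F × L2 Ω F) where
  carrier := {q | ∃ g : Fin N → L2 Ω F, (q.1, g) ∈ H10 Ω F ∧
    ∀ p ∈ H10 Ω F, ∑ j, inner ℝ (g j) (p.2 j) = inner ℝ q.2 p.1}
  zero_mem' := ⟨0, (H10 Ω F).zero_mem, by simp⟩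
  add_mem' := by
    rintro a b ⟨g, hg, hg'⟩ ⟨h, hh, hh'⟩
    refine ⟨g + h, (H10 Ω F).add_mem hg hh, fun p hp => ?_⟩
    simp [inner_add_left, Finset.sum_add_distrib, hg' p hp, hh' p hp]
  smul_mem' := by
    rintro c a ⟨g, hg, hg'⟩
    refine ⟨c • g, (H10 Ω F).smul_mem c hg, fun p hp => ?_⟩
    simp [inner_smul_left, ← Finset.mul_sum, hg' p hp]

/-- The operator `A = -Δ` in `L²(Ω, F)` with Dirichlet boundary condition, defined by the form
`∑_j ⟨∂_j u, ∂_j v⟩` on `H¹₀(Ω, F)`. -/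
def dirichletLaplacian : L2 Ω F →ₗ.[ℝ] L2 Ω F :=
  (laplacianGraph Ω F).toLinearPMap

theorem testWithGradient_mem_H10 [CompleteSpace F] (ψ : 𝓓(Ω, F)) :
    testWithGradient Ω F ψ ∈ H10 Ω F := by
  refine ⟨fun j η => ?_, Submodule.le_topologicalClosure _ ⟨ψ, rfl⟩⟩
  have h1 : ∀ᵐ x ∂(volume.restrict (Ω : Set (Space N))), testToL2 Ω F ψ x = ψ x :=
    (testFunction_memLp Ω F ψ).coeFn_toLp
  have h2 : ∀ᵐ x ∂(volume.restrict (Ω : Set (Space N))),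
      (testWithGradient Ω F ψ).2 j x = lineDeriv ℝ ψ x (basisVec j) := by
    filter_upwards [(testFunction_memLp Ω F
      (TestFunction.lineDerivCLM ℝ (basisVec j) ψ : 𝓓(Ω, F))).coeFn_toLp] with x hx
    rw [lineDeriv_testFunction]
    exact hx
  have hz : ∀ x, x ∉ (Ω : Set (Space N)) → η x = 0 := fun x hx =>
    image_eq_zero_of_notMem_tsupport fun h => hx (η.tsupport_subset h)
  have hz' : ∀ x, x ∉ (Ω : Set (Space N)) → lineDeriv ℝ η x (basisVec j) = 0 := fun x hx => by
    rw [lineDeriv_testFunction]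
    exact image_eq_zero_of_notMem_tsupport fun h => hx (TestFunction.tsupport_subset _ h)
  rw [integral_congr_ae (g := fun x => lineDeriv ℝ η x (basisVec j) • ψ x),
    integral_congr_ae (f := fun x => η x • (testWithGradient Ω F ψ).2 j x)
      (g := fun x => η x • lineDeriv ℝ ψ x (basisVec j)),
    setIntegral_eq_integral_of_forall_compl_eq_zero (fun x hx => by simp [hz' x hx]),
    setIntegral_eq_integral_of_forall_compl_eq_zero (fun x hx => by simp [hz x hx])]
  · have hd : ∀ x, lineDeriv ℝ η x (basisVec j) = fderiv ℝ η x (basisVec j) := fun x =>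
      (η.contDiff.differentiable (by simp)).differentiableAt.lineDeriv_eq_fderiv
    have hd' : ∀ x, lineDeriv ℝ ψ x (basisVec j) = fderiv ℝ ψ x (basisVec j) := fun x =>
      (ψ.contDiff.differentiable (by simp)).differentiableAt.lineDeriv_eq_fderiv
    have hc : Continuous fun x => lineDeriv ℝ η x (basisVec j) := by
      simp only [lineDeriv_testFunction]; fun_prop
    have hc' : Continuous fun x => lineDeriv ℝ ψ x (basisVec j) := by
      simp only [lineDeriv_testFunction]; fun_prop
    have hs : HasCompactSupport fun x => lineDeriv ℝ η x (basisVec j) := by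
      simp only [lineDeriv_testFunction]; exact TestFunction.hasCompactSupport _
    have i1 : Integrable (fun x => lineDeriv ℝ η x (basisVec j) • ψ x) :=
      (hc.smul ψ.continuous).integrable_of_hasCompactSupport hs.smul_right
    have i2 : Integrable (fun x => η x • lineDeriv ℝ ψ x (basisVec j)) :=
      (η.continuous.smul hc').integrable_of_hasCompactSupport η.hasCompactSupport.smul_right
    have i3 : Integrable (fun x => η x • ψ x) :=
      (η.continuous.smul ψ.continuous).integrable_of_hasCompactSupport
        η.hasCompactSupport.smul_right
    simp only [hd, hd'] at i1 i2 ⊢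
    have := integral_smul_fderiv_eq_neg_fderiv_smul_of_integrable i1 i2 i3
      (fun x _ => (η.contDiff.differentiable (by simp)).differentiableAt)
      (fun x _ => (ψ.contDiff.differentiable (by simp)).differentiableAt)
    rw [this, neg_neg]
  · filter_upwards [h2] with x hx
    rw [hx]
  · filter_upwards [h1] with x hx
    change _ • testToL2 Ω F ψ x = _
    rw [hx]

theorem eq_zero_of_integral_test {Ω : Opens (Space N)} {F : Type*} [NormedAddCommGroup F]
    [InnerProductSpace ℝ F] [CompleteSpace F] (f : L2 Ω F)
    (h : ∀ η : 𝓓(Ω, ℝ), ∫ x in (Ω : Set (Space N)), η x • f x = 0) : f = 0 := by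
  have hloc : LocallyIntegrableOn (f : Space N → F) (Ω : Set (Space N)) :=
    (locallyIntegrableOn_of_locallyIntegrable_restrict
      ((Lp.memLp f).locallyIntegrable (by norm_num)))
  have := Ω.isOpen.ae_eq_zero_of_integral_contDiff_smul_eq_zero hloc fun g hg hc hs => by
    rw [← h ⟨g, hg, hc, hs⟩]
    refine (setIntegral_eq_integral_of_forall_compl_eq_zero fun x hx => ?_).symm
    have : g x = 0 := image_eq_zero_of_notMem_tsupport fun h => hx (hs h)
    simp [this]
  refine (Lp.eq_zero_iff_ae_eq_zero).2 ?_
  exact (ae_restrict_iff' Ω.isOpen.measurableSet).2 this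

/-- The graph of the Dirichlet Laplacian is single valued. -/
theorem laplacianGraph_functional [CompleteSpace F] (q : L2 Ω F × L2 Ω F)
    (hq : q ∈ laplacianGraph Ω F) (h0 : q.1 = 0) : q.2 = 0 := by
  obtain ⟨g, hg, hgq⟩ := hq
  have hg0 : g = 0 := by
    funext j
    refine eq_zero_of_integral_test _ fun η => ?_
    have h := hg.1 j η
    rw [integral_eq_zero_of_ae, eq_comm, neg_eq_zero] at h
    · exact h
    · filter_upwards [Lp.coeFn_zero F 2 (volume.restrict (Ω : Set (Space N)))] with x hx
      simp only [h0]
      rw [hx]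
      simp
  refine eq_zero_of_integral_test _ fun η => ?_
  refine ext_inner_right ℝ fun c => ?_
  have hψ : ∃ ψ : 𝓓(Ω, F), ∀ x, ψ x = η x • c :=
    ⟨⟨fun x => η x • c, η.contDiff.smul contDiff_const, η.hasCompactSupport.smul_right,
      (tsupport_smul_subset_left _ _).trans η.tsupport_subset⟩, fun _ => rfl⟩
  obtain ⟨ψ, hψ⟩ := hψ
  have h := hgq _ (testWithGradient_mem_H10 Ω F ψ)
  rw [hg0] at h
  simp only [Pi.zero_apply, inner_zero_left, Finset.sum_const_zero] at h
  rw [inner_zero_left, real_inner_comm,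
    ← integral_inner (integrable_testFunction_smul Ω F η q.2) c, h, L2.inner_def]
  refine integral_congr_ae ?_
  filter_upwards [(testFunction_memLp Ω F ψ).coeFn_toLp] with x hx
  have hx' : (testWithGradient Ω F ψ).1 x = η x • c := by
    rw [← hψ]
    exact hx
  rw [hx', inner_smul_right, inner_smul_right, real_inner_comm]

/-- `u ∈ D(A)` and `A u = f` iff `(u, f)` belongs to `laplacianGraph Ω F`. -/
theorem dirichletLaplacian_graph [CompleteSpace F] :
    (dirichletLaplacian Ω F).graph = laplacianGraph Ω F :=
  Submodule.toLinearPMap_graph_eq _ (laplacianGraph_functional Ω F)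

end Sobolev

/-- The first eigenvalue `λ₁` of the scalar Dirichlet Laplacian on `Ω`. -/
def firstEigenvalue {N : ℕ} (Ω : Opens (Space N)) : ℝ :=
  sInf {l : ℝ | ∃ φ : (dirichletLaplacian Ω ℝ).domain,
    (φ : L2 Ω ℝ) ≠ 0 ∧ dirichletLaplacian Ω ℝ φ = l • (φ : L2 Ω ℝ)}

/-- The cone `K` of the functions in `L²(Ω, ℝ^M)` with nonnegative components. -/
def cone {N : ℕ} (Ω : Opens (Space N)) (M : ℕ) : Set (L2 Ω (Space M)) :=
  {u | ∀ᵐ x ∂(volume.restrict (Ω : Set (Space N))), ∀ i, 0 ≤ u x i}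

/-- The Nemytskii operator `G` of the matrix `D`, `G(u)(x) = D u(x)`. -/
def nemytskii {N M : ℕ} (Ω : Opens (Space N)) (D : Matrix (Fin M) (Fin M) ℝ) :
    L2 Ω (Space M) →L[ℝ] L2 Ω (Space M) :=
  (Matrix.toEuclideanCLM (𝕜 := ℝ) D).compLpL 2 (volume.restrict (Ω : Set (Space N)))

/-- The set `(A - G)⁻¹(w)` of all `u ∈ D(A)` with `A u - G(u) = w`. -/
def solutions {N M : ℕ} (Ω : Opens (Space N)) (D : Matrix (Fin M) (Fin M) ℝ)
    (w : L2 Ω (Space M)) : Set (L2 Ω (Space M)) :=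
  {u | ∃ hu : u ∈ (dirichletLaplacian Ω (Space M)).domain,
    dirichletLaplacian Ω (Space M) ⟨u, hu⟩ - nemytskii Ω D u = w}

/-- `D` is quasi-nonnegative: its off-diagonal entries are nonnegative. -/
def QuasiNonneg {M : ℕ} (D : Matrix (Fin M) (Fin M) ℝ) : Prop :=
  ∀ i j, i ≠ j → 0 ≤ D i j

/-- The set `σ₊(D)` of the real eigenvalues of `D` with an eigenvector in `ℝ^M_+`. -/
def sigmaPlus {M : ℕ} (D : Matrix (Fin M) (Fin M) ℝ) : Set ℝ :=
  {l | ∃ v : Fin M → ℝ, v ≠ 0 ∧ (∀ i, 0 ≤ v i) ∧ D.mulVec v = l • v}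

/-- The spectral bound `s(D) = max Re σ(D)`, where `σ(D)` is the complex spectrum. -/
def spectralBound {M : ℕ} (D : Matrix (Fin M) (Fin M) ℝ) : ℝ :=
  sSup (Complex.re '' spectrum ℂ (D.map Complex.ofReal))

end

end DirichletSystem

open DirichletSystem

/-! Everything rests on an a.e. positive scalar eigenfunction `φ` for `λ₁`. If `Au = Gu + w`,
pairing each component with `φ` turns the system into linear algebra: the moments `v i = ⟨u i, φ⟩`
satisfy `Dv + ⟨w, φ⟩ = λ₁ v`, and `v ≥ 0` when `u ∈ K`. For `w = 0`, `v` would be a nonnegative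
eigenvector unless `v = 0`, and then positivity of `φ` gives `u = 0`. For `w = φ (1, …, 1)` one gets
`Dv < λ₁ v` in every row, which forces `s(D) ≤ λ₁` (`spectralBound_le_of_mulVec_lt`).

The bulk of the work is the existence of `φ` (`exists_pos_eigenfunction`). A minimizing sequence for
the Rayleigh quotient can be taken among nonnegative test functions, since smoothing `|ψ|` does not
raise the energy. Rellich compactness, proved by mollification, gives an `L²` limit, and the
parallelogram law upgrades the convergence to `H¹`.

For strict positivity, the equation is tested with `ζ² / (χ + ε)`, where `χ` approximates `φ`. This
logarithmic estimate bounds the weak gradient of `log (1 + φ / ε)` independently of `ε`. Divided by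
`log (1 / ε)`, these functions tend to the indicator of `{φ > 0}`, whose weak gradient therefore
vanishes. On a connected set `{φ > 0}` is then null or of full measure, and `φ ≠ 0` excludes the
former. -/

namespace DirichletSystem

/-! ### Spectral bound of quasi-nonnegative matrices -/

/-- A quasi-nonnegative matrix with a strict nonnegative supersolution for `l` has spectral bound
at most `l`. -/
theorem spectralBound_le_of_mulVec_lt {M : ℕ} (hM : 0 < M) {D : Matrix (Fin M) (Fin M) ℝ}
    (hD : QuasiNonneg D) {l : ℝ} {v : Fin M → ℝ} (hv : ∀ i, 0 ≤ v i)
    (h : ∀ i, D.mulVec v i < l * v i) : spectralBound D ≤ l := by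
  classical
  have : Nonempty (Fin M) := ⟨⟨0, hM⟩⟩
  have hsum : ∀ i, ∑ j ∈ Finset.univ.erase i, D i j * v j < (l - D i i) * v i := by
    intro i
    have h1 := h i
    rw [Matrix.mulVec, dotProduct, ← Finset.add_sum_erase _ _ (Finset.mem_univ i)] at h1
    linarith
  have hnn : ∀ i, 0 ≤ ∑ j ∈ Finset.univ.erase i, D i j * v j := fun i =>
    Finset.sum_nonneg fun j hj => mul_nonneg (hD i j (Finset.ne_of_mem_erase hj).symm) (hv j)
  -- At a zero of `v` the off-diagonal sum in `hsum` would be negative.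
  have hpos : ∀ i, 0 < v i := by
    intro i
    refine lt_of_le_of_ne (hv i) fun h0 => ?_
    have h1 := hsum i
    rw [← h0, mul_zero] at h1
    exact absurd (hnn i) (not_le.2 h1)
  refine csSup_le ((spectrum.nonempty_of_isAlgClosed_of_finiteDimensional ℂ _).image _) ?_
  rintro _ ⟨μ, hμ, rfl⟩
  rw [← Matrix.spectrum_toLin', ← Module.End.hasEigenvalue_iff_mem_spectrum] at hμ
  obtain ⟨ξ, hξ⟩ := hμ.exists_hasEigenvector
  have hξ1 : (D.map Complex.ofReal).mulVec ξ = μ • ξ := by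
    simpa using hξ.apply_eq_smul
  -- Gershgorin's argument in the norm weighted by `v`: the row where `‖ξ i‖ / v i` is largest
  -- confines `μ` to a disc about `D i i` of radius less than `l - D i i`.
  obtain ⟨i, -, hi⟩ := Finset.exists_max_image Finset.univ (fun i => ‖ξ i‖ / v i)
    Finset.univ_nonempty
  set r := ‖ξ i‖ / v i with hr
  have hle : ∀ j, ‖ξ j‖ ≤ r * v j := fun j => (div_le_iff₀ (hpos j)).1 (hi j (Finset.mem_univ j))
  have hri : ‖ξ i‖ = r * v i := by rw [hr, div_mul_cancel₀ _ (hpos i).ne']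
  have hrpos : 0 < r := by
    by_contra hr0
    refine hξ.2 (funext fun j => norm_le_zero_iff.1 ((hle j).trans ?_))
    exact mul_nonpos_of_nonpos_of_nonneg (not_lt.1 hr0) (hv j)
  have hrow : (μ - D i i) * ξ i = ∑ j ∈ Finset.univ.erase i, (D i j : ℂ) * ξ j := by
    have h1 := congrFun hξ1 i
    rw [Matrix.mulVec, dotProduct, ← Finset.add_sum_erase _ _ (Finset.mem_univ i)] at h1
    simp only [Matrix.map_apply, Pi.smul_apply, smul_eq_mul] at h1
    rw [sub_mul, ← h1]
    ring
  have hb : ‖μ - D i i‖ * (r * v i) ≤ r * ∑ j ∈ Finset.univ.erase i, D i j * v j := by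
    rw [← hri, ← norm_mul, hrow, Finset.mul_sum]
    refine (norm_sum_le _ _).trans (Finset.sum_le_sum fun j hj => ?_)
    have hd := hD i j (Finset.ne_of_mem_erase hj).symm
    rw [norm_mul, Complex.norm_real, Real.norm_of_nonneg hd]
    nlinarith [mul_le_mul_of_nonneg_left (hle j) hd]
  have hlt : ‖μ - D i i‖ < l - D i i := by
    have : ‖μ - D i i‖ * (r * v i) < (l - D i i) * (r * v i) := by
      nlinarith [mul_lt_mul_of_pos_left (hsum i) hrpos]
    exact lt_of_mul_lt_mul_right this (mul_pos hrpos (hpos i)).le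
  have := (Complex.re_le_norm (μ - D i i)).trans hlt.le
  simp only [Complex.sub_re, Complex.ofReal_re] at this
  linarith

/-! ### Closedness of `H¹` and `H¹₀`, and stability under linear maps of the target -/

section Sobolev

variable {N : ℕ} {Ω : Opens (Space N)} {F G : Type*} [NormedAddCommGroup F]
  [InnerProductSpace ℝ F] [NormedAddCommGroup G] [InnerProductSpace ℝ G]

theorem norm_integral_testFunction_smul_le (η : 𝓓(Ω, ℝ)) (u : L2 Ω F) :
    ‖∫ x in (Ω : Set (Space N)), η x • u x‖ ≤ ‖testToL2 Ω ℝ η‖ * ‖u‖ := by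
  have h := norm_integral_le_integral_norm (μ := volume.restrict (Ω : Set (Space N)))
    (fun x => η x • u x)
  refine h.trans ?_
  have h2 : ∫ x in (Ω : Set (Space N)), ‖η x • u x‖ =
      inner ℝ (testFunction_memLp Ω ℝ η).norm.toLp (Lp.memLp u).norm.toLp := by
    rw [L2.inner_def]
    refine integral_congr_ae ?_
    filter_upwards [(testFunction_memLp Ω ℝ η).norm.coeFn_toLp, (Lp.memLp u).norm.coeFn_toLp]
      with x h1 h2
    simp only [h1, h2, norm_smul]
    simp [mul_comm]
  rw [h2]
  refine (real_inner_le_norm _ _).trans (le_of_eq ?_)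
  congr 1
  · rw [Lp.norm_toLp, eLpNorm_norm]
    exact (Lp.norm_toLp _ (testFunction_memLp Ω ℝ η)).symm
  · rw [Lp.norm_toLp, eLpNorm_norm, Lp.norm_def]

/-- Both sides of each weak derivative identity depend continuously on the pair, by Cauchy–Schwarz
(`norm_integral_testFunction_smul_le`). -/
theorem isClosed_H1 : IsClosed (H1 Ω F : Set (L2 Ω F × (Fin N → L2 Ω F))) := by
  have key : ∀ η : 𝓓(Ω, ℝ), Continuous fun u : L2 Ω F =>
      ∫ x in (Ω : Set (Space N)), η x • u x := by
    intro η
    let T : L2 Ω F →ₗ[ℝ] F :=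
      { toFun := fun u => ∫ x in (Ω : Set (Space N)), η x • u x
        map_add' := fun u v => by
          rw [← integral_add (integrable_testFunction_smul Ω F _ _)
            (integrable_testFunction_smul Ω F _ _)]
          refine integral_congr_ae ?_
          filter_upwards [Lp.coeFn_add u v] with x hx
          rw [hx, Pi.add_apply, smul_add]
        map_smul' := fun c u => by
          rw [RingHom.id_apply, ← integral_smul]
          refine integral_congr_ae ?_
          filter_upwards [Lp.coeFn_smul c u] with x hx
          rw [hx, Pi.smul_apply, smul_comm] }
    exact (T.mkContinuous _ (norm_integral_testFunction_smul_le η)).continuous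
  have : (H1 Ω F : Set (L2 Ω F × (Fin N → L2 Ω F))) = ⋂ (j : Fin N) (η : 𝓓(Ω, ℝ)),
      {p | ∫ x in (Ω : Set (Space N)),
        (TestFunction.lineDerivCLM ℝ (basisVec j) η : 𝓓(Ω, ℝ)) x • p.1 x =
          - ∫ x in (Ω : Set (Space N)), η x • p.2 j x} := by
    ext p
    simp only [Set.mem_iInter, Set.mem_ofPred_eq, ← lineDeriv_testFunction]
    rfl
  rw [this]
  refine isClosed_iInter fun j => isClosed_iInter fun η => isClosed_eq ?_ ?_
  · exact (key _).comp continuous_fst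
  · exact ((key η).comp ((continuous_apply j).comp continuous_snd)).neg

/-- Since `H1` is closed and contains the test functions, intersecting with it changes nothing.
Closed conditions on `H10` may thus be checked on test functions. -/
theorem H10_eq_topologicalClosure [CompleteSpace F] :
    H10 Ω F = (LinearMap.range (testWithGradient Ω F)).topologicalClosure := by
  refine inf_eq_right.2 (Submodule.topologicalClosure_minimal _ ?_ isClosed_H1)
  rintro _ ⟨ψ, rfl⟩
  exact (testWithGradient_mem_H10 Ω F ψ).1

theorem isClosed_H10 : IsClosed (H10 Ω F : Set (L2 Ω F × (Fin N → L2 Ω F))) :=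
  isClosed_H1.inter (Submodule.isClosed_topologicalClosure _)

/-- `H¹₀` is stable under composition with continuous linear maps of the target. -/
theorem compLp_mem_H10 [CompleteSpace F] [CompleteSpace G] (T : F →L[ℝ] G)
    {p : L2 Ω F × (Fin N → L2 Ω F)} (hp : p ∈ H10 Ω F) :
    (T.compLp p.1, fun j => T.compLp (p.2 j)) ∈ H10 Ω G := by
  let S : L2 Ω F × (Fin N → L2 Ω F) → L2 Ω G × (Fin N → L2 Ω G) := fun p =>
    (T.compLpL 2 (volume.restrict (Ω : Set (Space N))) p.1,
      fun j => T.compLpL 2 (volume.restrict (Ω : Set (Space N))) (p.2 j))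
  have hS : Continuous S := by fun_prop
  -- Post-composition is continuous and `H10 Ω G` is closed, so test functions suffice.
  have hmaps : Set.MapsTo S (LinearMap.range (testWithGradient Ω F)) (H10 Ω G) := by
    rintro _ ⟨ψ, rfl⟩
    have hmk : ∀ ψ : 𝓓(Ω, F), T.compLp (testToL2 Ω F ψ) =
        testToL2 Ω G (TestFunction.postcompCLM T ψ) := by
      intro ψ
      ext1
      filter_upwards [T.coeFn_compLp (testToL2 Ω F ψ), (testFunction_memLp Ω F ψ).coeFn_toLp,
        (testFunction_memLp Ω G (TestFunction.postcompCLM T ψ)).coeFn_toLp] with x h1 h2 h3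
      rw [h1]
      refine Eq.trans ?_ h3.symm
      change T (((testFunction_memLp Ω F ψ).toLp ψ) x) = _
      rw [h2]
      rfl
    have : S (testWithGradient Ω F ψ) =
        testWithGradient Ω G (TestFunction.postcompCLM T ψ) := by
      refine Prod.ext (hmk ψ) (funext fun j => ?_)
      refine (hmk (TestFunction.lineDerivCLM ℝ (basisVec j) ψ)).trans ?_
      change _ = testToL2 Ω G (TestFunction.lineDerivCLM ℝ (basisVec j) _)
      congr 1
      ext x
      rw [← lineDeriv_testFunction]
      change T ((TestFunction.lineDerivCLM ℝ (basisVec j) ψ : 𝓓(Ω, F)) x) =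
        lineDeriv ℝ (fun y => T (ψ y)) x (basisVec j)
      rw [← lineDeriv_testFunction]
      have hd := (ψ.contDiff.differentiable (by simp)).differentiableAt (x := x)
      rw [show (fun y => T (ψ y)) = T ∘ ψ from rfl, hd.lineDeriv_eq_fderiv,
        DifferentiableAt.lineDeriv_eq_fderiv (T.differentiableAt.comp x hd),
        fderiv_comp _ T.differentiableAt hd]
      simp
    rw [this]
    exact testWithGradient_mem_H10 Ω G _
  rw [H10_eq_topologicalClosure] at hp
  have := map_mem_closure hS hp hmaps
  rwa [isClosed_H10.closure_eq] at this

end Sobolev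

/-! ### Translation and mollification estimates for test functions -/

section Rellich

variable {N : ℕ} {Ω : Opens (Space N)}

/-- The Dirichlet energy `∑_j ‖∂_j u‖²` of an element of `H¹`, recorded with its gradient. -/
noncomputable def energy (p : L2 Ω ℝ × (Fin N → L2 Ω ℝ)) : ℝ := ∑ j, ‖p.2 j‖ ^ 2

/-- The partial derivative of a test function, as a test function. -/
noncomputable def partialDeriv (j : Fin N) (ψ : 𝓓(Ω, ℝ)) : 𝓓(Ω, ℝ) :=
  TestFunction.lineDerivCLM ℝ (basisVec j) ψ

theorem testWithGradient_fst (ψ : 𝓓(Ω, ℝ)) : (testWithGradient Ω ℝ ψ).1 = testToL2 Ω ℝ ψ := rfl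

theorem testWithGradient_snd (ψ : 𝓓(Ω, ℝ)) (j : Fin N) :
    (testWithGradient Ω ℝ ψ).2 j = testToL2 Ω ℝ (partialDeriv j ψ) := rfl

theorem differentiable_testFunction (ψ : 𝓓(Ω, ℝ)) : Differentiable ℝ ψ :=
  ψ.contDiff.differentiable (by simp)

theorem partialDeriv_apply (j : Fin N) (ψ : 𝓓(Ω, ℝ)) (x : Space N) :
    partialDeriv j ψ x = fderiv ℝ ψ x (basisVec j) := by
  rw [partialDeriv, ← lineDeriv_testFunction]
  exact (differentiable_testFunction ψ x).lineDeriv_eq_fderiv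

theorem coeFn_testToL2 (ψ : 𝓓(Ω, ℝ)) :
    ∀ᵐ x ∂(volume.restrict (Ω : Set (Space N))), testToL2 Ω ℝ ψ x = ψ x :=
  (testFunction_memLp Ω ℝ ψ).coeFn_toLp

theorem testFunction_eq_zero (ψ : 𝓓(Ω, ℝ)) {x : Space N} (hx : x ∉ (Ω : Set (Space N))) :
    ψ x = 0 :=
  image_eq_zero_of_notMem_tsupport fun h => hx (ψ.tsupport_subset h)

theorem inner_testToL2 (u : L2 Ω ℝ) (ψ : 𝓓(Ω, ℝ)) :
    inner ℝ u (testToL2 Ω ℝ ψ) = ∫ x in (Ω : Set (Space N)), u x * ψ x := by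
  rw [L2.inner_def]
  refine integral_congr_ae ?_
  filter_upwards [coeFn_testToL2 ψ] with x hx
  rw [hx]
  exact mul_comm _ _

/-- Passing to an integral over the whole space makes translation invariance available. -/
theorem norm_sq_testToL2 (ψ : 𝓓(Ω, ℝ)) : ‖testToL2 Ω ℝ ψ‖ ^ 2 = ∫ x, ψ x ^ 2 := by
  rw [← real_inner_self_eq_norm_sq, inner_testToL2,
    ← setIntegral_eq_integral_of_forall_compl_eq_zero (s := (Ω : Set (Space N)))
      (f := fun x => ψ x ^ 2) (fun x hx => by simp [testFunction_eq_zero ψ hx])]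
  refine integral_congr_ae ?_
  filter_upwards [coeFn_testToL2 ψ] with x hx
  rw [hx, sq]

theorem integrable_testFunction_sq (ψ : 𝓓(Ω, ℝ)) : Integrable fun x => ψ x ^ 2 :=
  Continuous.integrable_of_hasCompactSupport (ψ.continuous.pow 2)
    (HasCompactSupport.comp_left (g := fun t : ℝ => t ^ 2) ψ.hasCompactSupport (by simp))

theorem ofReal_norm_sq_testToL2 (ψ : 𝓓(Ω, ℝ)) :
    ENNReal.ofReal (‖testToL2 Ω ℝ ψ‖ ^ 2) = ∫⁻ x, ENNReal.ofReal (ψ x ^ 2) := by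
  rw [norm_sq_testToL2, ofReal_integral_eq_lintegral_ofReal (integrable_testFunction_sq ψ)
    (Filter.Eventually.of_forall fun x => sq_nonneg _)]

/-- Jensen's inequality for the square and a probability density `ρ`. -/
theorem sq_integral_mul_le {α : Type*} [MeasurableSpace α] {μ : Measure α} {ρ f : α → ℝ}
    (h0 : ∀ x, 0 ≤ ρ x) (h1 : ∫ x, ρ x ∂μ = 1) (hf : Integrable (fun x => ρ x * f x) μ)
    (hf2 : Integrable (fun x => ρ x * f x ^ 2) μ) :
    (∫ x, ρ x * f x ∂μ) ^ 2 ≤ ∫ x, ρ x * f x ^ 2 ∂μ := by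
  have hρ : Integrable ρ μ := by
    by_contra h
    rw [integral_undef h] at h1
    exact zero_ne_one h1
  set m := ∫ x, ρ x * f x ∂μ
  -- This is the variance `∫ ρ (f - m)²`, expanded.
  have h : 0 ≤ ∫ x, ρ x * f x ^ 2 - 2 * m * (ρ x * f x) + m ^ 2 * ρ x ∂μ := by
    refine integral_nonneg fun x => ?_
    have : ρ x * f x ^ 2 - 2 * m * (ρ x * f x) + m ^ 2 * ρ x = ρ x * (f x - m) ^ 2 := by ring
    rw [Pi.zero_apply, this]
    exact mul_nonneg (h0 x) (sq_nonneg _)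
  have hi : Integrable (fun x => ρ x * f x ^ 2 - 2 * m * (ρ x * f x)) μ :=
    hf2.sub (hf.const_mul _)
  rw [integral_add hi (hρ.const_mul _), integral_sub hf2 (hf.const_mul _),
    integral_const_mul, integral_const_mul, h1] at h
  nlinarith

/-- The fundamental theorem of calculus on the segment from `x` to `x - y`, then Jensen in `t`. -/
theorem sq_sub_translate_le (ψ : 𝓓(Ω, ℝ)) (x y : Space N) :
    ENNReal.ofReal ((ψ (x - y) - ψ x) ^ 2) ≤
      ∫⁻ t in Set.Ioc (0 : ℝ) 1, ENNReal.ofReal (fderiv ℝ ψ (x - t • y) y ^ 2) := by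
  have hc : Continuous fun t : ℝ => fderiv ℝ ψ (x - t • y) y := by
    have := ψ.contDiff.continuous_fderiv (by simp)
    fun_prop
  have hderiv : ∀ t : ℝ, HasDerivAt (fun t : ℝ => ψ (x - t • y))
      (-fderiv ℝ ψ (x - t • y) y) t := by
    intro t
    have h1 : HasDerivAt (fun t : ℝ => x - t • y) (-y) t := by
      simpa using ((hasDerivAt_id t).smul_const y).const_sub x
    have h2 := (differentiable_testFunction ψ (x - t • y)).hasFDerivAt.comp_hasDerivAt t h1
    rw [map_neg] at h2
    exact h2
  have hftc := intervalIntegral.integral_eq_sub_of_hasDerivAt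
    (fun t _ => hderiv t) (hc.neg.intervalIntegrable 0 1)
  simp only [one_smul, zero_smul, sub_zero] at hftc
  rw [← hftc, intervalIntegral.integral_of_le zero_le_one]
  have h2 : IntegrableOn (fun t : ℝ => fderiv ℝ ψ (x - t • y) y ^ 2) (Set.Ioc 0 1) :=
    ((hc.pow 2).continuousOn.integrableOn_Icc).mono_set Set.Ioc_subset_Icc_self
  have h1 : IntegrableOn (fun t : ℝ => fderiv ℝ ψ (x - t • y) y) (Set.Ioc 0 1) :=
    (hc.continuousOn.integrableOn_Icc).mono_set Set.Ioc_subset_Icc_self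
  rw [← ofReal_integral_eq_lintegral_ofReal h2
    (Filter.Eventually.of_forall fun t => sq_nonneg _)]
  refine ENNReal.ofReal_le_ofReal ?_
  rw [integral_neg, neg_sq]
  have := sq_integral_mul_le (μ := volume.restrict (Set.Ioc (0 : ℝ) 1)) (ρ := fun _ => 1)
    (f := fun t : ℝ => fderiv ℝ ψ (x - t • y) y) (fun _ => zero_le_one) (by simp)
    (by simp only [one_mul]; exact h1) (by simp only [one_mul]; exact h2)
  simpa using this

theorem sum_smul_basisVec (y : Space N) : ∑ j, y j • basisVec j = y := by
  have := (EuclideanSpace.basisFun (Fin N) ℝ).sum_repr y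
  simpa [basisVec] using this

theorem sq_fderiv_apply_le (ψ : 𝓓(Ω, ℝ)) (x y : Space N) :
    fderiv ℝ ψ x y ^ 2 ≤ ‖y‖ ^ 2 * ∑ j, partialDeriv j ψ x ^ 2 := by
  have h : fderiv ℝ ψ x y = ∑ j, y j * partialDeriv j ψ x := by
    conv_lhs => rw [← sum_smul_basisVec y]
    simp [partialDeriv_apply]
  rw [h, EuclideanSpace.real_norm_sq_eq]
  exact Finset.sum_mul_sq_le_sq_mul_sq _ _ _

theorem lintegral_sum_partialDeriv_sq (ψ : 𝓓(Ω, ℝ)) :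
    ∫⁻ x, ENNReal.ofReal (∑ j, partialDeriv j ψ x ^ 2) =
      ENNReal.ofReal (energy (testWithGradient Ω ℝ ψ)) := by
  rw [energy, ENNReal.ofReal_sum_of_nonneg fun j _ => sq_nonneg _]
  simp only [testWithGradient_snd, ofReal_norm_sq_testToL2]
  rw [← lintegral_finsetSum]
  · refine lintegral_congr fun x => ?_
    rw [ENNReal.ofReal_sum_of_nonneg fun j _ => sq_nonneg _]
  · intro j _
    have := (partialDeriv j ψ).continuous
    fun_prop

/-- Integrate the segment estimate in `x`: after Tonelli, translation invariance removes the shift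
by `t • y`. -/
theorem lintegral_sq_sub_translate_le (ψ : 𝓓(Ω, ℝ)) (y : Space N) :
    ∫⁻ x, ENNReal.ofReal ((ψ (x - y) - ψ x) ^ 2) ≤
      ENNReal.ofReal (‖y‖ ^ 2 * energy (testWithGradient Ω ℝ ψ)) := by
  have hc := ψ.contDiff.continuous_fderiv (by simp)
  calc ∫⁻ x, ENNReal.ofReal ((ψ (x - y) - ψ x) ^ 2)
      ≤ ∫⁻ x, ∫⁻ t in Set.Ioc (0 : ℝ) 1, ENNReal.ofReal (fderiv ℝ ψ (x - t • y) y ^ 2) :=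
        lintegral_mono fun x => sq_sub_translate_le ψ x y
    _ = ∫⁻ t in Set.Ioc (0 : ℝ) 1, ∫⁻ x, ENNReal.ofReal (fderiv ℝ ψ (x - t • y) y ^ 2) := by
        refine lintegral_lintegral_swap (Measurable.aemeasurable ?_)
        refine (Continuous.measurable ?_).ennreal_ofReal
        fun_prop
    _ = ∫⁻ _t in Set.Ioc (0 : ℝ) 1, ∫⁻ x, ENNReal.ofReal (fderiv ℝ ψ x y ^ 2) := by
        refine lintegral_congr fun t => ?_
        exact lintegral_sub_right_eq_self (fun x => ENNReal.ofReal (fderiv ℝ ψ x y ^ 2)) (t • y)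
    _ = ∫⁻ x, ENNReal.ofReal (fderiv ℝ ψ x y ^ 2) := by simp
    _ ≤ ∫⁻ x, ENNReal.ofReal (‖y‖ ^ 2) * ENNReal.ofReal (∑ j, partialDeriv j ψ x ^ 2) := by
        refine lintegral_mono fun x => ?_
        rw [← ENNReal.ofReal_mul (sq_nonneg _)]
        exact ENNReal.ofReal_le_ofReal (sq_fderiv_apply_le ψ x y)
    _ = ENNReal.ofReal (‖y‖ ^ 2 * energy (testWithGradient Ω ℝ ψ)) := by
        rw [lintegral_const_mul' _ _ ENNReal.ofReal_ne_top, lintegral_sum_partialDeriv_sq,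
          ENNReal.ofReal_mul (sq_nonneg _)]

/-- A mollification with a density supported in the ball of radius `δ` moves a test function in
`L²` by at most `δ` times the norm of its gradient. -/
theorem lintegral_sq_mollify_sub_le (ψ : 𝓓(Ω, ℝ)) {ρ : Space N → ℝ} (hρc : Continuous ρ)
    (hρs : HasCompactSupport ρ) (hρ0 : ∀ y, 0 ≤ ρ y) (hρ1 : ∫ y, ρ y = 1) {δ : ℝ}
    (hδ : ∀ y, ρ y ≠ 0 → ‖y‖ ≤ δ) :
    ∫⁻ x, ENNReal.ofReal (((∫ y, ρ y * ψ (x - y)) - ψ x) ^ 2) ≤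
      ENNReal.ofReal (δ ^ 2 * energy (testWithGradient Ω ℝ ψ)) := by
  have hψ := ψ.continuous
  have hρi : Integrable ρ := hρc.integrable_of_hasCompactSupport hρs
  have hintg : ∀ f : Space N → ℝ, Continuous f → Integrable fun y => ρ y * f y := fun f hf =>
    (hρc.mul hf).integrable_of_hasCompactSupport hρs.mul_right
  -- As `ρ` has mass one, the error is the `ρ`-average of `ψ (x - y) - ψ x`.
  have hjensen : ∀ x, ENNReal.ofReal (((∫ y, ρ y * ψ (x - y)) - ψ x) ^ 2) ≤
      ∫⁻ y, ENNReal.ofReal (ρ y) * ENNReal.ofReal ((ψ (x - y) - ψ x) ^ 2) := by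
    intro x
    have h1 : (∫ y, ρ y * ψ (x - y)) - ψ x = ∫ y, ρ y * (ψ (x - y) - ψ x) := by
      simp only [mul_sub]
      rw [integral_sub (hintg _ (by fun_prop)) (hintg _ (by fun_prop)), integral_mul_const, hρ1,
        one_mul]
    have h2 := hintg (fun y => (ψ (x - y) - ψ x) ^ 2) (by fun_prop)
    rw [h1]
    refine (ENNReal.ofReal_le_ofReal (sq_integral_mul_le hρ0 hρ1 (hintg _ (by fun_prop)) h2)).trans
      (le_of_eq ?_)
    rw [ofReal_integral_eq_lintegral_ofReal h2
      (Filter.Eventually.of_forall fun y => mul_nonneg (hρ0 y) (sq_nonneg _))]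
    exact lintegral_congr fun y => ENNReal.ofReal_mul (hρ0 y)
  calc ∫⁻ x, ENNReal.ofReal (((∫ y, ρ y * ψ (x - y)) - ψ x) ^ 2)
      ≤ ∫⁻ x, ∫⁻ y, ENNReal.ofReal (ρ y) * ENNReal.ofReal ((ψ (x - y) - ψ x) ^ 2) :=
        lintegral_mono hjensen
    _ = ∫⁻ y, ∫⁻ x, ENNReal.ofReal (ρ y) * ENNReal.ofReal ((ψ (x - y) - ψ x) ^ 2) := by
        refine lintegral_lintegral_swap (Measurable.aemeasurable ?_)
        simp only [Function.uncurry_def]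
        fun_prop
    _ ≤ ∫⁻ y, ENNReal.ofReal (ρ y) *
          ENNReal.ofReal (δ ^ 2 * energy (testWithGradient Ω ℝ ψ)) := by
        refine lintegral_mono fun y => ?_
        rw [lintegral_const_mul' _ _ ENNReal.ofReal_ne_top]
        by_cases hy : ρ y = 0
        · simp [hy]
        · gcongr
          refine (lintegral_sq_sub_translate_le ψ y).trans (ENNReal.ofReal_le_ofReal ?_)
          gcongr
          · exact Finset.sum_nonneg fun j _ => sq_nonneg _
          · exact hδ y hy
    _ = ENNReal.ofReal (δ ^ 2 * energy (testWithGradient Ω ℝ ψ)) := by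
        rw [lintegral_mul_const' _ _ ENNReal.ofReal_ne_top,
          ← ofReal_integral_eq_lintegral_ofReal hρi (Filter.Eventually.of_forall hρ0), hρ1,
          ENNReal.ofReal_one, one_mul]

end Rellich

/-! ### Friedrichs' inequality and Rellich compactness -/

section Compactness

variable {N : ℕ} {Ω : Opens (Space N)}

theorem energy_nonneg (p : L2 Ω ℝ × (Fin N → L2 Ω ℝ)) : 0 ≤ energy p :=
  Finset.sum_nonneg fun _ _ => sq_nonneg _

theorem volume_ne_top_of_isBounded (hbdd : Bornology.IsBounded (Ω : Set (Space N))) :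
    volume (Ω : Set (Space N)) ≠ ⊤ :=
  hbdd.measure_lt_top.ne

/-- The translates of a Lipschitz function with compact support, seen in `L²(Ω)`, form a
continuous family. -/
theorem continuous_toLp_translate (hbdd : Bornology.IsBounded (Ω : Set (Space N)))
    {ρ : Space N → ℝ} {L : NNReal} (hL : LipschitzWith L ρ)
    (hmem : ∀ x, MemLp (fun z => ρ (x - z)) 2 (volume.restrict (Ω : Set (Space N)))) :
    Continuous fun x => (hmem x).toLp := by
  have : IsFiniteMeasure (volume.restrict (Ω : Set (Space N))) :=
    ⟨by simpa using hbdd.measure_lt_top⟩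
  set c : ℝ := (measureUnivNNReal (volume.restrict (Ω : Set (Space N))) : ℝ) ^
    (2 : ENNReal).toReal⁻¹
  have hc : 0 ≤ c := by positivity
  refine (LipschitzWith.of_dist_le_mul (K := c.toNNReal * L) fun x y => ?_).continuous
  rw [dist_eq_norm, ← MemLp.toLp_sub, NNReal.coe_mul,
    Real.coe_toNNReal _ hc, mul_assoc]
  refine Lp.norm_le_of_ae_bound (by positivity) ?_
  filter_upwards [((hmem x).sub (hmem y)).coeFn_toLp] with z hz
  rw [hz, Pi.sub_apply, ← dist_eq_norm]
  refine (hL.dist_le_mul _ _).trans (le_of_eq ?_)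
  simp

/-- Split `χ² ≤ 2 (ρ ∗ χ - χ)² + 2 (ρ ∗ χ)²`: the gradient controls the first term, the pointwise
bound `B` on the bounded set `Ω` the second. -/
theorem norm_sq_le_of_mollify_le (hbdd : Bornology.IsBounded (Ω : Set (Space N))) (χ : 𝓓(Ω, ℝ))
    {ρ : Space N → ℝ} (hρc : Continuous ρ) (hρs : HasCompactSupport ρ) (hρ0 : ∀ y, 0 ≤ ρ y)
    (hρ1 : ∫ y, ρ y = 1) {δ : ℝ} (hρδ : ∀ y, ρ y ≠ 0 → ‖y‖ ≤ δ) {B : ℝ} (hB0 : 0 ≤ B)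
    (hB : ∀ x ∈ (Ω : Set (Space N)), (∫ y, ρ y * χ (x - y)) ^ 2 ≤ B) :
    ‖testToL2 Ω ℝ χ‖ ^ 2 ≤ 2 * (δ ^ 2 * energy (testWithGradient Ω ℝ χ)) +
      2 * B * (volume (Ω : Set (Space N))).toReal := by
  have hV := volume_ne_top_of_isBounded hbdd
  set V := (volume (Ω : Set (Space N))).toReal with hVdef
  have hV0 : 0 ≤ V := ENNReal.toReal_nonneg
  have hB2 : 0 ≤ 2 * B := by positivity
  have hE := energy_nonneg (testWithGradient Ω ℝ χ)
  set E := energy (testWithGradient Ω ℝ χ)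
  have hmain : ENNReal.ofReal (‖testToL2 Ω ℝ χ‖ ^ 2) ≤ ENNReal.ofReal (2 * (δ ^ 2 * E) + 2 * B * V) := by
    have hz : ∫⁻ x, ENNReal.ofReal (χ x ^ 2) =
        ∫⁻ x in (Ω : Set (Space N)), ENNReal.ofReal (χ x ^ 2) := by
      rw [← lintegral_indicator Ω.isOpen.measurableSet]
      refine lintegral_congr fun x => ?_
      by_cases hx : x ∈ (Ω : Set (Space N))
      · rw [Set.indicator_of_mem hx]
      · rw [Set.indicator_of_notMem hx, testFunction_eq_zero χ hx]; simp
    rw [ofReal_norm_sq_testToL2, hz]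
    calc ∫⁻ x in (Ω : Set (Space N)), ENNReal.ofReal (χ x ^ 2)
        ≤ ∫⁻ x in (Ω : Set (Space N)),
            (ENNReal.ofReal 2 * ENNReal.ofReal (((∫ y, ρ y * χ (x - y)) - χ x) ^ 2) +
              ENNReal.ofReal (2 * B)) := by
          refine setLIntegral_mono' Ω.isOpen.measurableSet fun x hx => ?_
          rw [← ENNReal.ofReal_mul zero_le_two, ← ENNReal.ofReal_add (by positivity) hB2]
          refine ENNReal.ofReal_le_ofReal ?_
          have h1 := hB x hx
          nlinarith [sq_nonneg (2 * (∫ y, ρ y * χ (x - y)) - χ x)]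
      _ = ENNReal.ofReal 2 * (∫⁻ x in (Ω : Set (Space N)),
            ENNReal.ofReal (((∫ y, ρ y * χ (x - y)) - χ x) ^ 2)) +
              ENNReal.ofReal (2 * B) * volume (Ω : Set (Space N)) := by
          rw [lintegral_add_right _ measurable_const,
            lintegral_const_mul' _ _ ENNReal.ofReal_ne_top, setLIntegral_const]
      _ ≤ ENNReal.ofReal 2 * ENNReal.ofReal (δ ^ 2 * E) + ENNReal.ofReal (2 * B) * ENNReal.ofReal V := by
          rw [ENNReal.ofReal_toReal hV]
          gcongr
          exact (setLIntegral_le_lintegral _ _).trans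
            (lintegral_sq_mollify_sub_le χ hρc hρs hρ0 hρ1 hρδ)
      _ = ENNReal.ofReal (2 * (δ ^ 2 * E) + 2 * B * V) := by
          rw [← ENNReal.ofReal_mul zero_le_two, ← ENNReal.ofReal_mul hB2,
            ← ENNReal.ofReal_add (by positivity) (by positivity)]
  exact (ENNReal.ofReal_le_ofReal_iff (by positivity)).1 hmain

/-- Friedrichs' inequality: up to finitely many functionals, the `L²` norm is controlled by a
small multiple of the `H¹` norm. -/
theorem friedrichs_inequality (hbdd : Bornology.IsBounded (Ω : Set (Space N))) {κ : ℝ}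
    (hκ : 0 < κ) : ∃ (s : Finset (L2 Ω ℝ)) (C : ℝ), 0 ≤ C ∧ ∀ χ : 𝓓(Ω, ℝ),
      ‖testToL2 Ω ℝ χ‖ ^ 2 ≤ κ * (‖testToL2 Ω ℝ χ‖ ^ 2 + energy (testWithGradient Ω ℝ χ)) +
        C * ∑ k ∈ s, inner ℝ k (testToL2 Ω ℝ χ) ^ 2 := by
  have hV := volume_ne_top_of_isBounded hbdd
  set V := (volume (Ω : Set (Space N))).toReal with hVdef
  have hV0 : 0 ≤ V := ENNReal.toReal_nonneg
  -- Chosen so that the mollification error `2 δ² E` equals `κ E`.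
  set δ := Real.sqrt (κ / 2) with hδdef
  have hδ : 0 < δ := Real.sqrt_pos.2 (by positivity)
  have hδ2 : δ ^ 2 = κ / 2 := Real.sq_sqrt (by positivity)
  let b : ContDiffBump (0 : Space N) := ⟨δ / 2, δ, by positivity, by linarith⟩
  set ρ : Space N → ℝ := b.normed volume with hρdef
  have hρcd : ContDiff ℝ 1 ρ := b.contDiff_normed (n := 1)
  have hρs : HasCompactSupport ρ := b.hasCompactSupport_normed
  have hρc : Continuous ρ := hρcd.continuous
  have hρ0 : ∀ y, 0 ≤ ρ y := fun y => b.nonneg_normed y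
  have hρ1 : ∫ y, ρ y = 1 := b.integral_normed
  have hρδ : ∀ y, ρ y ≠ 0 → ‖y‖ ≤ δ := by
    intro y hy
    have : y ∈ Function.support (b.normed volume) := hy
    rw [b.support_normed_eq, mem_ball_zero_iff] at this
    exact this.le
  obtain ⟨L, hL⟩ := hρcd.lipschitzWith_of_hasCompactSupport hρs one_ne_zero
  have hmem : ∀ x, MemLp (fun z => ρ (x - z)) 2 (volume.restrict (Ω : Set (Space N))) := by
    intro x
    refine Continuous.memLp_of_hasCompactSupport (by fun_prop) ?_
    exact hρs.comp_homeomorph (Homeomorph.subLeft x)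
  set k : Space N → L2 Ω ℝ := fun x => (hmem x).toLp with hk
  have hkc : Continuous k := continuous_toLp_translate hbdd hL hmem
  -- The value of `ρ ∗ χ` at `x` is the pairing with `k x`. By compactness, finitely many such
  -- functionals determine all these values up to `r ‖u‖`.
  have hcomp : IsCompact (k '' closure (Ω : Set (Space N))) :=
    hbdd.isCompact_closure.image hkc
  -- Makes `4 r² V ≤ κ`, which absorbs the error of the finite cover.
  set r := Real.sqrt (κ / (4 * (V + 1))) with hr
  have hrpos : 0 < r := Real.sqrt_pos.2 (by positivity)
  have hr2 : r ^ 2 = κ / (4 * (V + 1)) := Real.sq_sqrt (by positivity)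
  obtain ⟨t, -, htf, ht⟩ := hcomp.finite_cover_balls hrpos
  refine ⟨htf.toFinset, 4 * V, by positivity, fun χ => ?_⟩
  set u := testToL2 Ω ℝ χ with hu
  set S := ∑ k ∈ htf.toFinset, inner ℝ k u ^ 2 with hS
  have hmoll : ∀ x, ∫ y, ρ y * χ (x - y) = inner ℝ (k x) u := by
    intro x
    rw [hu, inner_testToL2, ← integral_sub_left_eq_self _ volume x,
      ← setIntegral_eq_integral_of_forall_compl_eq_zero (s := (Ω : Set (Space N)))]
    · refine integral_congr_ae ?_
      filter_upwards [(hmem x).coeFn_toLp] with z hz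
      rw [hk]
      simp only [hz, sub_sub_cancel]
    · intro z hz
      rw [sub_sub_cancel, testFunction_eq_zero χ hz, mul_zero]
  have hsup : ∀ x ∈ (Ω : Set (Space N)), (inner ℝ (k x) u) ^ 2 ≤ 2 * S + 2 * r ^ 2 * ‖u‖ ^ 2 := by
    intro x hx
    have hx' := ht ⟨x, subset_closure hx, rfl⟩
    simp only [Set.mem_iUnion, exists_prop] at hx'
    obtain ⟨a, hat, hxa⟩ := hx'
    have h1 : inner ℝ a u ^ 2 ≤ S :=
      Finset.single_le_sum (f := fun k => (inner ℝ k u : ℝ) ^ 2) (fun _ _ => sq_nonneg _)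
        (htf.mem_toFinset.2 hat)
    have h2 : (inner ℝ (k x - a) u) ^ 2 ≤ r ^ 2 * ‖u‖ ^ 2 := by
      rw [← mul_pow, ← sq_abs]
      refine pow_le_pow_left₀ (abs_nonneg _) ((abs_real_inner_le_norm _ _).trans ?_) 2
      refine mul_le_mul_of_nonneg_right ?_ (norm_nonneg _)
      rw [← dist_eq_norm]
      exact (Metric.mem_ball.1 hxa).le
    have h3 : inner ℝ (k x) u = inner ℝ a u + inner ℝ (k x - a) u := by
      rw [← inner_add_left]; congr 1; abel
    rw [h3]
    nlinarith [sq_nonneg (inner ℝ a u - inner ℝ (k x - a) u : ℝ)]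
  have hS0 : 0 ≤ S := Finset.sum_nonneg fun _ _ => sq_nonneg _
  have hE := energy_nonneg (testWithGradient Ω ℝ χ)
  set E := energy (testWithGradient Ω ℝ χ)
  have hfin := norm_sq_le_of_mollify_le hbdd χ hρc hρs hρ0 hρ1 hρδ
    (B := 2 * S + 2 * r ^ 2 * ‖u‖ ^ 2) (by positivity) fun x hx => by
      rw [hmoll]; exact hsup x hx
  have hrV : 4 * r ^ 2 * V ≤ κ := by
    rw [hr2]
    have : 4 * (κ / (4 * (V + 1))) * V = κ * (V / (V + 1)) := by field_simp
    rw [this]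
    exact mul_le_of_le_one_right hκ.le ((div_le_one (by positivity)).2 (by linarith))
  have h1 := mul_le_mul_of_nonneg_right hrV (sq_nonneg ‖u‖)
  rw [hδ2, ← hVdef, ← hu] at hfin
  linarith

/-- Converts lower bounds for the energy of a sum into upper bounds for that of a difference. -/
theorem energy_sub_add_energy_add (p q : L2 Ω ℝ × (Fin N → L2 Ω ℝ)) :
    energy (p - q) + energy (p + q) = 2 * energy p + 2 * energy q := by
  simp only [energy, Finset.mul_sum, ← Finset.sum_add_distrib]
  refine Finset.sum_congr rfl fun j _ => ?_
  have := parallelogram_law_with_norm ℝ (p.2 j) (q.2 j)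
  simp only [Prod.snd_add, Prod.snd_sub, Pi.add_apply, Pi.sub_apply]
  linarith

set_option maxHeartbeats 800000 in
/-- Rellich's theorem for test functions. -/
theorem totallyBounded_testToL2 (hbdd : Bornology.IsBounded (Ω : Set (Space N))) (C : ℝ) :
    TotallyBounded (testToL2 Ω ℝ ''
      {χ | ‖testToL2 Ω ℝ χ‖ ≤ C ∧ energy (testWithGradient Ω ℝ χ) ≤ C}) := by
  classical
  refine Metric.totallyBounded_of_finite_discretization fun ε hε => ?_
  -- Bounds the squared `H¹` norm of a difference of two members of the set, so that the Friedrichs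
  -- term with `κ = ε² / (2m)` is at most `ε² / 2`.
  set m := 4 * C ^ 2 + 4 * |C| + 1 with hm
  have hm0 : 0 < m := by positivity
  obtain ⟨s, K, hK, hs⟩ := friedrichs_inequality hbdd (κ := ε ^ 2 / (2 * m)) (by positivity)
  let T : L2 Ω ℝ →L[ℝ] (s → ℝ) := ContinuousLinearMap.pi fun k => innerSL ℝ (k : L2 Ω ℝ)
  set c := K * s.card + 1 with hc
  have hc0 : 0 < c := by positivity
  -- Elements whose functionals `T` agree up to `τ` contribute at most `c τ² = ε² / 4` from the
  -- finite sum.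
  set τ := Real.sqrt (ε ^ 2 / (4 * c)) with hτ
  have hτ0 : 0 < τ := Real.sqrt_pos.2 (by positivity)
  have hτ2 : τ ^ 2 = ε ^ 2 / (4 * c) := Real.sq_sqrt (by positivity)
  obtain ⟨t, -, htf, ht⟩ :=
    (isCompact_closedBall (0 : s → ℝ) (‖T‖ * C)).finite_cover_balls (half_pos hτ0)
  have hcov : ∀ u ∈ testToL2 Ω ℝ ''
      {χ | ‖testToL2 Ω ℝ χ‖ ≤ C ∧ energy (testWithGradient Ω ℝ χ) ≤ C},
      ∃ a : htf.toFinset, dist (T u) a < τ / 2 := by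
    rintro _ ⟨χ, ⟨h1, -⟩, rfl⟩
    have h2 : T (testToL2 Ω ℝ χ) ∈ Metric.closedBall (0 : s → ℝ) (‖T‖ * C) := by
      rw [mem_closedBall_zero_iff]
      exact (T.le_opNorm _).trans (mul_le_mul_of_nonneg_left h1 (norm_nonneg _))
    have h3 := ht h2
    simp only [Set.mem_iUnion, exists_prop] at h3
    obtain ⟨a, hat, ha⟩ := h3
    exact ⟨⟨a, htf.mem_toFinset.2 hat⟩, ha⟩
  choose f hf using hcov
  refine ⟨htf.toFinset, inferInstance, fun u => f u.1 u.2, ?_⟩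
  rintro ⟨u, hu⟩ ⟨v, hv⟩ huv
  have hdist : dist (T u) (T v) < τ := by
    have h1 := hf u hu
    have h2 := hf v hv
    simp only at huv
    rw [← huv, dist_comm] at h2
    linarith [dist_triangle (T u) (f u hu) (T v)]
  obtain ⟨χ, ⟨hχ1, hχ2⟩, rfl⟩ := hu
  obtain ⟨ξ, ⟨hξ1, hξ2⟩, rfl⟩ := hv
  have hfr := hs (χ - ξ)
  rw [map_sub, map_sub] at hfr
  rw [dist_eq_norm, ← map_sub] at hdist
  change dist (testToL2 Ω ℝ χ) (testToL2 Ω ℝ ξ) < ε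
  rw [dist_eq_norm]
  set d := testToL2 Ω ℝ χ - testToL2 Ω ℝ ξ
  have hsum : ∑ k ∈ s, inner ℝ k d ^ 2 ≤ s.card * τ ^ 2 := by
    rw [← nsmul_eq_mul]
    refine Finset.sum_le_card_nsmul _ _ _ fun k hk => ?_
    rw [← sq_abs]
    refine pow_le_pow_left₀ (abs_nonneg _) ?_ 2
    exact (norm_le_pi_norm (T d) ⟨k, hk⟩).trans hdist.le
  have hd : ‖d‖ ≤ 2 * C := (norm_sub_le _ _).trans (by linarith)
  have hd2 : ‖d‖ ^ 2 ≤ 4 * C ^ 2 := by nlinarith [norm_nonneg d]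
  have hen : energy (testWithGradient Ω ℝ χ - testWithGradient Ω ℝ ξ) ≤ 4 * |C| := by
    have h1 := energy_sub_add_energy_add (testWithGradient Ω ℝ χ) (testWithGradient Ω ℝ ξ)
    have h2 := energy_nonneg (testWithGradient Ω ℝ χ + testWithGradient Ω ℝ ξ)
    linarith [le_abs_self C]
  have h1 : ε ^ 2 / (2 * m) *
      (‖d‖ ^ 2 + energy (testWithGradient Ω ℝ χ - testWithGradient Ω ℝ ξ)) ≤ ε ^ 2 / 2 := by
    have : ε ^ 2 / 2 = ε ^ 2 / (2 * m) * m := by field_simp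
    rw [this]
    refine mul_le_mul_of_nonneg_left ?_ (by positivity)
    rw [hm]
    linarith
  have h2 : K * ∑ k ∈ s, inner ℝ k d ^ 2 ≤ ε ^ 2 / 4 := by
    have : ε ^ 2 / 4 = c * τ ^ 2 := by rw [hτ2]; field_simp
    rw [this]
    refine (mul_le_mul_of_nonneg_left hsum hK).trans ?_
    rw [hc]
    nlinarith [sq_nonneg τ]
  refine lt_of_pow_lt_pow_left₀ 2 hε.le ?_
  nlinarith [pow_pos hε 2]

end Compactness

/-! ### A nonnegative minimizer of the Rayleigh quotient -/

section Minimizer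

open Filter Topology

variable {N : ℕ} {Ω : Opens (Space N)}

theorem norm_sq_le_energy (p : L2 Ω ℝ × (Fin N → L2 Ω ℝ)) (j : Fin N) :
    ‖p.2 j‖ ^ 2 ≤ energy p :=
  Finset.single_le_sum (f := fun j => ‖p.2 j‖ ^ 2) (fun _ _ => sq_nonneg _) (Finset.mem_univ j)

theorem energy_smul (c : ℝ) (p : L2 Ω ℝ × (Fin N → L2 Ω ℝ)) :
    energy (c • p) = c ^ 2 * energy p := by
  simp only [energy, Finset.mul_sum]
  refine Finset.sum_congr rfl fun j _ => ?_
  rw [Prod.smul_snd, Pi.smul_apply, norm_smul, mul_pow, Real.norm_eq_abs, sq_abs]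

theorem continuous_energy :
    Continuous (energy : L2 Ω ℝ × (Fin N → L2 Ω ℝ) → ℝ) := by
  unfold energy
  fun_prop

/-- The infimum of the Rayleigh quotient over the test functions. -/
noncomputable def rayleighInf (Ω : Opens (Space N)) : ℝ :=
  sInf {e | ∃ ψ : 𝓓(Ω, ℝ), ‖testToL2 Ω ℝ ψ‖ = 1 ∧ e = energy (testWithGradient Ω ℝ ψ)}

theorem rayleighInf_nonneg : 0 ≤ rayleighInf Ω :=
  Real.sInf_nonneg (by rintro _ ⟨ψ, -, rfl⟩; exact energy_nonneg _)

theorem rayleighInf_le_energy {ψ : 𝓓(Ω, ℝ)} (hψ : ‖testToL2 Ω ℝ ψ‖ = 1) :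
    rayleighInf Ω ≤ energy (testWithGradient Ω ℝ ψ) :=
  csInf_le ⟨0, by rintro _ ⟨ψ, -, rfl⟩; exact energy_nonneg _⟩ ⟨ψ, hψ, rfl⟩

/-- Homogeneity gives this for test functions, and both sides are continuous in the `H¹` topology.
-/
theorem rayleighInf_mul_norm_sq_le {p : L2 Ω ℝ × (Fin N → L2 Ω ℝ)} (hp : p ∈ H10 Ω ℝ) :
    rayleighInf Ω * ‖p.1‖ ^ 2 ≤ energy p := by
  rw [H10_eq_topologicalClosure] at hp
  refine closure_minimal (t := {p | rayleighInf Ω * ‖p.1‖ ^ 2 ≤ energy p}) ?_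
    (isClosed_le (by fun_prop) continuous_energy) hp
  rintro _ ⟨ψ, rfl⟩
  change rayleighInf Ω * ‖testToL2 Ω ℝ ψ‖ ^ 2 ≤ energy (testWithGradient Ω ℝ ψ)
  rcases eq_or_ne ‖testToL2 Ω ℝ ψ‖ 0 with h0 | h0
  · rw [h0]
    simpa using energy_nonneg _
  · have h1 : ‖testToL2 Ω ℝ (‖testToL2 Ω ℝ ψ‖⁻¹ • ψ)‖ = 1 := by
      rw [map_smul, norm_smul, norm_inv, norm_norm, inv_mul_cancel₀ h0]
    have h2 := rayleighInf_le_energy h1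
    rw [map_smul, energy_smul, inv_pow, inv_mul_eq_div] at h2
    exact (le_div_iff₀ (by positivity)).1 h2

theorem exists_testFunction_norm_eq_one (hne : (Ω : Set (Space N)).Nonempty) :
    ∃ ψ : 𝓓(Ω, ℝ), ‖testToL2 Ω ℝ ψ‖ = 1 := by
  obtain ⟨x, hx⟩ := hne
  obtain ⟨r, hr, hball⟩ := Metric.nhds_basis_closedBall.mem_iff.1 (Ω.isOpen.mem_nhds hx)
  let b : ContDiffBump x := ⟨r / 2, r, by positivity, by linarith⟩
  let ψ : 𝓓(Ω, ℝ) := ⟨b, b.contDiff, b.hasCompactSupport, by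
    rw [b.tsupport_eq]; exact hball⟩
  have hψ : 0 < ‖testToL2 Ω ℝ ψ‖ ^ 2 := by
    rw [norm_sq_testToL2]
    refine Continuous.integral_pos_of_hasCompactSupport_nonneg_nonzero (x := x)
      (ψ.continuous.pow 2)
      (HasCompactSupport.comp_left (g := fun t : ℝ => t ^ 2) ψ.hasCompactSupport (by simp))
      (fun _ => sq_nonneg _) ?_
    have : ψ x = 1 := b.one_of_mem_closedBall (by simpa using b.rIn_pos.le)
    simp [this]
  have h0 : ‖testToL2 Ω ℝ ψ‖ ≠ 0 := fun h => by simp [h] at hψ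
  refine ⟨‖testToL2 Ω ℝ ψ‖⁻¹ • ψ, ?_⟩
  rw [map_smul, norm_smul, norm_inv, norm_norm, inv_mul_cancel₀ h0]

/-- A nonnegative test function which approximates `|ψ|` and does not increase the energy. -/
theorem exists_nonneg_testFunction (hbdd : Bornology.IsBounded (Ω : Set (Space N)))
    (ψ : 𝓓(Ω, ℝ)) {ε : ℝ} (hε : 0 < ε) : ∃ χ : 𝓓(Ω, ℝ), (∀ x, 0 ≤ χ x) ∧
      ‖testToL2 Ω ℝ χ‖ ≤ ‖testToL2 Ω ℝ ψ‖ ∧ ‖testToL2 Ω ℝ ψ‖ - ε ≤ ‖testToL2 Ω ℝ χ‖ ∧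
      energy (testWithGradient Ω ℝ χ) ≤ energy (testWithGradient Ω ℝ ψ) := by
  have : IsFiniteMeasure (volume.restrict (Ω : Set (Space N))) :=
    ⟨by simpa using hbdd.measure_lt_top⟩
  set c : ℝ := (measureUnivNNReal (volume.restrict (Ω : Set (Space N))) : ℝ) ^
    (2 : ENNReal).toReal⁻¹
  have hc : 0 ≤ c := by positivity
  -- With `c = |Ω|^(1/2)`, a pointwise error of `δ` costs at most `ε` in `L²`.
  set δ := ε / (c + 1) with hδ
  have hδ0 : 0 < δ := by positivity
  have hcδ : c * δ ≤ ε := by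
    rw [hδ, mul_div_assoc', div_le_iff₀ (by positivity)]
    nlinarith
  have hpos : ∀ x, 0 < ψ x ^ 2 + δ ^ 2 := fun x => by positivity
  -- This smooth substitute for `|ψ|` vanishes where `ψ` does, lies between `|ψ| - δ` and `|ψ|`, and
  -- its gradient is that of `ψ` times a factor of modulus at most one.
  have hsm : ContDiff ℝ ∞ fun x => Real.sqrt (ψ x ^ 2 + δ ^ 2) - δ :=
    (((ψ.contDiff.pow 2).add contDiff_const).sqrt fun x => (hpos x).ne').sub contDiff_const
  have hsub : tsupport (fun x => Real.sqrt (ψ x ^ 2 + δ ^ 2) - δ) ⊆ tsupport ψ := by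
    refine closure_mono fun x hx => ?_
    contrapose! hx
    have hx0 : ψ x = 0 := by simpa using hx
    simp [hx0, Real.sqrt_sq hδ0.le]
  let χ : 𝓓(Ω, ℝ) := ⟨fun x => Real.sqrt (ψ x ^ 2 + δ ^ 2) - δ, hsm,
    ψ.hasCompactSupport.of_isClosed_subset (isClosed_tsupport _) hsub,
    hsub.trans ψ.tsupport_subset⟩
  have hχ : ∀ x, χ x = Real.sqrt (ψ x ^ 2 + δ ^ 2) - δ := fun _ => rfl
  have hlow : ∀ x, |ψ x| - δ ≤ χ x := fun x => by
    rw [hχ]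
    gcongr
    exact Real.abs_le_sqrt (by nlinarith)
  have hnn : ∀ x, 0 ≤ χ x := fun x => by
    rw [hχ, sub_nonneg]
    exact Real.le_sqrt_of_sq_le (by nlinarith [sq_nonneg (ψ x)])
  have hup : ∀ x, χ x ≤ |ψ x| := fun x => by
    rw [hχ, sub_le_iff_le_add]
    refine Real.sqrt_le_iff.2 ⟨by positivity, ?_⟩
    nlinarith [sq_abs (ψ x), abs_nonneg (ψ x)]
  refine ⟨χ, hnn, ?_, ?_, ?_⟩
  · refine Lp.norm_le_norm_of_ae_le ?_
    filter_upwards [coeFn_testToL2 χ, coeFn_testToL2 ψ] with x h1 h2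
    rw [h1, h2, Real.norm_of_nonneg (hnn x)]
    exact hup x
  · have h1 : ‖|testToL2 Ω ℝ ψ| - testToL2 Ω ℝ χ‖ ≤ c * δ := by
      refine Lp.norm_le_of_ae_bound hδ0.le ?_
      filter_upwards [coeFn_testToL2 χ, coeFn_testToL2 ψ, Lp.coeFn_abs (testToL2 Ω ℝ ψ),
        Lp.coeFn_sub |testToL2 Ω ℝ ψ| (testToL2 Ω ℝ χ)] with x h1 h2 h3 h4
      rw [h4, Pi.sub_apply, h3, h1, h2, Real.norm_of_nonneg (sub_nonneg.2 (hup x))]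
      linarith [hlow x]
    have h2 := norm_sub_norm_le |testToL2 Ω ℝ ψ| (testToL2 Ω ℝ χ)
    rw [norm_abs_eq_norm] at h2
    linarith
  · refine Finset.sum_le_sum fun j _ => pow_le_pow_left₀ (norm_nonneg _) ?_ 2
    refine Lp.norm_le_norm_of_ae_le ?_
    filter_upwards [coeFn_testToL2 (partialDeriv j χ), coeFn_testToL2 (partialDeriv j ψ)]
      with x h1 h2
    rw [testWithGradient_snd, testWithGradient_snd, h1, h2, partialDeriv_apply,
      partialDeriv_apply]
    have hd := (differentiable_testFunction ψ x).hasFDerivAt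
    have hd2 := (((hd.pow 2).add_const (δ ^ 2)).sqrt (hpos x).ne').sub_const δ
    have hd3 : fderiv ℝ χ x = _ := hd2.fderiv
    rw [hd3]
    have hs := Real.sqrt_pos.2 (hpos x)
    have hle : |ψ x| ≤ Real.sqrt (ψ x ^ 2 + δ ^ 2) := Real.abs_le_sqrt (by nlinarith)
    simp only [smul_apply, smul_eq_mul, norm_mul, Real.norm_eq_abs]
    rw [← mul_assoc, ← abs_mul]
    refine mul_le_of_le_one_left (abs_nonneg _) ?_
    have he : 1 / (2 * Real.sqrt (ψ x ^ 2 + δ ^ 2)) * (2 • ψ x ^ (2 - 1)) =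
        ψ x / Real.sqrt (ψ x ^ 2 + δ ^ 2) := by
      simp only [nsmul_eq_mul, Nat.cast_ofNat]
      field_simp
      simp
    rw [he, abs_div, abs_of_pos hs]
    exact (div_le_one hs).2 hle

/-- Smoothing `|ψ|` may lose a little mass, so the norms only tend to one. The lower bound
`rayleighInf Ω * ‖χ n‖²` still squeezes the energies. -/
theorem exists_minimizing_sequence (hbdd : Bornology.IsBounded (Ω : Set (Space N)))
    (hne : (Ω : Set (Space N)).Nonempty) : ∃ χ : ℕ → 𝓓(Ω, ℝ), (∀ n x, 0 ≤ χ n x) ∧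
      (∀ n, ‖testToL2 Ω ℝ (χ n)‖ ≤ 1) ∧
      Tendsto (fun n => ‖testToL2 Ω ℝ (χ n)‖) atTop (𝓝 1) ∧
      (∀ n, energy (testWithGradient Ω ℝ (χ n)) ≤ rayleighInf Ω + 1) ∧
      Tendsto (fun n => energy (testWithGradient Ω ℝ (χ n))) atTop (𝓝 (rayleighInf Ω)) := by
  have hstep : ∀ n : ℕ, ∃ χ : 𝓓(Ω, ℝ), (∀ x, 0 ≤ χ x) ∧ ‖testToL2 Ω ℝ χ‖ ≤ 1 ∧
      1 - 1 / ((n : ℝ) + 1) ≤ ‖testToL2 Ω ℝ χ‖ ∧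
      energy (testWithGradient Ω ℝ χ) ≤ rayleighInf Ω + 1 / ((n : ℝ) + 1) := by
    intro n
    have hn : (0 : ℝ) < 1 / ((n : ℝ) + 1) := by positivity
    obtain ⟨ψ₀, hψ₀⟩ := exists_testFunction_norm_eq_one hne
    obtain ⟨_, ⟨ψ, hψ, rfl⟩, hlt⟩ := exists_lt_of_csInf_lt
      (s := {e | ∃ ψ : 𝓓(Ω, ℝ), ‖testToL2 Ω ℝ ψ‖ = 1 ∧ e = energy (testWithGradient Ω ℝ ψ)})
      ⟨_, ψ₀, hψ₀, rfl⟩ (lt_add_of_pos_right (rayleighInf Ω) hn)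
    obtain ⟨χ, h1, h2, h3, h4⟩ := exists_nonneg_testFunction hbdd ψ hn
    rw [hψ] at h2 h3
    exact ⟨χ, h1, h2, h3, h4.trans hlt.le⟩
  choose χ h1 h2 h3 h4 using hstep
  have h0 : Tendsto (fun n : ℕ => 1 / ((n : ℝ) + 1)) atTop (𝓝 0) :=
    tendsto_one_div_add_atTop_nhds_zero_nat
  have hnorm : Tendsto (fun n => ‖testToL2 Ω ℝ (χ n)‖) atTop (𝓝 1) :=
    tendsto_of_tendsto_of_tendsto_of_le_of_le (by simpa using h0.const_sub 1)
      tendsto_const_nhds h3 h2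
  refine ⟨χ, h1, h2, hnorm, fun n => (h4 n).trans ?_, ?_⟩
  · gcongr
    rw [div_le_one (by positivity)]
    linarith [Nat.cast_nonneg (α := ℝ) n]
  · refine tendsto_of_tendsto_of_tendsto_of_le_of_le
      (g := fun n => rayleighInf Ω * ‖testToL2 Ω ℝ (χ n)‖ ^ 2)
      (h := fun n : ℕ => rayleighInf Ω + 1 / ((n : ℝ) + 1)) ?_ ?_ (fun n => ?_) h4
    · simpa only [one_pow, mul_one] using (hnorm.pow 2).const_mul (rayleighInf Ω)
    · simpa only [add_zero] using h0.const_add (rayleighInf Ω)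
    · have h5 := rayleighInf_mul_norm_sq_le (testWithGradient_mem_H10 Ω ℝ (χ n))
      rwa [testWithGradient_fst] at h5

/-- The Rayleigh quotient has a minimizer which is an `H¹` limit of nonnegative test functions. -/
theorem exists_nonneg_minimizer (hbdd : Bornology.IsBounded (Ω : Set (Space N)))
    (hne : (Ω : Set (Space N)).Nonempty) :
    ∃ (χ : ℕ → 𝓓(Ω, ℝ)) (p : L2 Ω ℝ × (Fin N → L2 Ω ℝ)), (∀ n x, 0 ≤ χ n x) ∧
      Tendsto (fun n => testWithGradient Ω ℝ (χ n)) atTop (𝓝 p) ∧ ‖p.1‖ = 1 ∧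
      energy p = rayleighInf Ω := by
  obtain ⟨χ, hnn, hle, hnorm, hEle, hE⟩ := exists_minimizing_sequence hbdd hne
  have hcomp := (totallyBounded_testToL2 hbdd (rayleighInf Ω + 1)).closure.isCompact_of_isClosed
    isClosed_closure
  obtain ⟨φ, -, f, hf, hlim⟩ := hcomp.tendsto_subseq (x := fun n => testToL2 Ω ℝ (χ n))
    fun n => subset_closure ⟨χ n,
      ⟨(hle n).trans (by linarith [rayleighInf_nonneg (Ω := Ω)]), hEle n⟩, rfl⟩
  set q : ℕ → L2 Ω ℝ × (Fin N → L2 Ω ℝ) := fun n => testWithGradient Ω ℝ (χ (f n)) with hq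
  have hq1 : Tendsto (fun n => (q n).1) atTop (𝓝 φ) := hlim
  have hqE : Tendsto (fun n => energy (q n)) atTop (𝓝 (rayleighInf Ω)) :=
    hE.comp hf.tendsto_atTop
  have hφ : ‖φ‖ = 1 := tendsto_nhds_unique hlim.norm (hnorm.comp hf.tendsto_atTop)
  have hfst : Tendsto (Prod.fst : ℕ × ℕ → ℕ) atTop atTop := by
    rw [← prod_atTop_atTop_eq]; exact tendsto_fst
  have hsnd : Tendsto (Prod.snd : ℕ × ℕ → ℕ) atTop atTop := by
    rw [← prod_atTop_atTop_eq]; exact tendsto_snd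
  -- By the parallelogram law and the Rayleigh bound for the sum, this quantity dominates the energy
  -- of `q n.1 - q n.2`. It tends to zero because `‖φ + φ‖² = 4`, so the gradients are Cauchy.
  have hdefect : Tendsto (fun n : ℕ × ℕ => 2 * energy (q n.1) + 2 * energy (q n.2) -
      rayleighInf Ω * ‖(q n.1).1 + (q n.2).1‖ ^ 2) atTop (𝓝 0) := by
    have h := (((hqE.comp hfst).const_mul 2).add ((hqE.comp hsnd).const_mul 2)).sub
      ((((hq1.comp hfst).add (hq1.comp hsnd)).norm.pow 2).const_mul (rayleighInf Ω))
    have h0 : 2 * rayleighInf Ω + 2 * rayleighInf Ω - rayleighInf Ω * ‖φ + φ‖ ^ 2 = 0 := by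
      rw [← two_smul ℝ φ, norm_smul, hφ]
      norm_num
      ring
    rw [h0] at h
    exact h
  have hcauchy : ∀ j, CauchySeq fun n => (q n).2 j := by
    intro j
    rw [cauchySeq_iff_tendsto_dist_atTop_0]
    refine squeeze_zero (fun _ => dist_nonneg) (fun n => ?_) (by simpa using hdefect.sqrt)
    refine Real.le_sqrt_of_sq_le ?_
    have h1 := energy_sub_add_energy_add (q n.1) (q n.2)
    have h2 := rayleighInf_mul_norm_sq_le ((H10 Ω ℝ).add_mem
      (testWithGradient_mem_H10 Ω ℝ (χ (f n.1))) (testWithGradient_mem_H10 Ω ℝ (χ (f n.2))))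
    have h3 : dist ((q n.1).2 j) ((q n.2).2 j) ^ 2 ≤ energy (q n.1 - q n.2) := by
      rw [dist_eq_norm]
      exact norm_sq_le_energy (q n.1 - q n.2) j
    change rayleighInf Ω * ‖(q n.1).1 + (q n.2).1‖ ^ 2 ≤ energy (q n.1 + q n.2) at h2
    linarith
  choose g hg using fun j => cauchySeq_tendsto_of_complete (hcauchy j)
  have hlimq : Tendsto q atTop (𝓝 (φ, g)) := hq1.prodMk_nhds (tendsto_pi_nhds.2 hg)
  exact ⟨fun n => χ (f n), (φ, g), fun n => hnn _, hlimq, hφ,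
    tendsto_nhds_unique ((continuous_energy.tendsto _).comp hlimq) hqE⟩

/-- The quadratic `t ↦ energy (p + t • q) - l ‖p.1 + t • q.1‖²` is nonnegative and vanishes at `t =
0`, so its linear coefficient is zero; the discriminant expresses this. -/
theorem euler_lagrange_of_minimizer {p : L2 Ω ℝ × (Fin N → L2 Ω ℝ)} (hp : p ∈ H10 Ω ℝ)
    (h1 : ‖p.1‖ = 1) (hE : energy p = rayleighInf Ω) {q : L2 Ω ℝ × (Fin N → L2 Ω ℝ)}
    (hq : q ∈ H10 Ω ℝ) :
    ∑ j, inner ℝ (p.2 j) (q.2 j) = inner ℝ (rayleighInf Ω • p.1) q.1 := by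
  set l := rayleighInf Ω
  have hquad : ∀ t : ℝ, 0 ≤ (energy q - l * ‖q.1‖ ^ 2) * (t * t) +
      (2 * (∑ j, inner ℝ (p.2 j) (q.2 j) - l * inner ℝ p.1 q.1)) * t + 0 := by
    intro t
    have h := rayleighInf_mul_norm_sq_le ((H10 Ω ℝ).add_mem hp ((H10 Ω ℝ).smul_mem t hq))
    have e1 : ‖(p + t • q).1‖ ^ 2 = 1 + 2 * t * inner ℝ p.1 q.1 + t ^ 2 * ‖q.1‖ ^ 2 := by
      rw [Prod.fst_add, Prod.smul_fst, norm_add_sq_real, h1, real_inner_smul_right, norm_smul,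
        mul_pow, Real.norm_eq_abs, sq_abs]
      ring
    have e2 : energy (p + t • q) =
        energy p + 2 * t * ∑ j, inner ℝ (p.2 j) (q.2 j) + t ^ 2 * energy q := by
      simp only [energy, Finset.mul_sum, ← Finset.sum_add_distrib]
      refine Finset.sum_congr rfl fun j _ => ?_
      rw [Prod.snd_add, Prod.smul_snd, Pi.add_apply, Pi.smul_apply, norm_add_sq_real,
        real_inner_smul_right, norm_smul, mul_pow, Real.norm_eq_abs, sq_abs]
      ring
    rw [e1, e2, hE] at h
    linarith
  have hdisc := discrim_le_zero hquad
  rw [discrim, mul_zero, sub_zero] at hdisc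
  have h0 := pow_eq_zero_iff two_ne_zero |>.1 (le_antisymm hdisc (sq_nonneg _))
  rw [real_inner_smul_left]
  linarith

/-- The minimizer is an eigenfunction, and any eigenfunction tested against itself has its
eigenvalue as Rayleigh quotient. -/
theorem rayleighInf_eq_firstEigenvalue {p : L2 Ω ℝ × (Fin N → L2 Ω ℝ)} (hp : p ∈ H10 Ω ℝ)
    (h1 : ‖p.1‖ = 1) (hE : energy p = rayleighInf Ω) :
    firstEigenvalue Ω = rayleighInf Ω := by
  have hgraph : ∀ l : ℝ, (∃ φ : (dirichletLaplacian Ω ℝ).domain,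
      (φ : L2 Ω ℝ) ≠ 0 ∧ dirichletLaplacian Ω ℝ φ = l • (φ : L2 Ω ℝ)) ↔
      ∃ φ : L2 Ω ℝ, φ ≠ 0 ∧ (φ, l • φ) ∈ laplacianGraph Ω ℝ := by
    intro l
    rw [← dirichletLaplacian_graph]
    constructor
    · rintro ⟨φ, h0, h⟩
      exact ⟨φ, h0, (LinearPMap.mem_graph_iff _).2 ⟨φ, rfl, h⟩⟩
    · rintro ⟨φ, h0, h⟩
      obtain ⟨y, rfl, hy⟩ := (LinearPMap.mem_graph_iff _).1 h
      exact ⟨y, h0, hy⟩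
  rw [firstEigenvalue]
  simp only [hgraph]
  refine IsLeast.csInf_eq ⟨⟨p.1, fun h => by simp [h] at h1, p.2, hp, fun q hq =>
    euler_lagrange_of_minimizer hp h1 hE hq⟩, ?_⟩
  rintro l ⟨φ, h0, g, hg, hl⟩
  have h2 := hl _ hg
  have h3 := rayleighInf_mul_norm_sq_le hg
  simp only [real_inner_self_eq_norm_sq, real_inner_smul_left] at h2
  rw [energy, h2] at h3
  exact le_of_mul_le_mul_right h3 (by positivity)

end Minimizer

/-! ### Sets with vanishing weak gradient in a connected domain -/

section Connected

open Filter Topology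

variable {N : ℕ} {Ω : Opens (Space N)}

/-- The convolution of `f` with the normalized bump function `b`. -/
noncomputable def mollify (b : ContDiffBump (0 : Space N)) (f : Space N → ℝ) : Space N → ℝ :=
  convolution (b.normed volume) f (ContinuousLinearMap.lsmul ℝ ℝ : ℝ →L[ℝ] ℝ →L[ℝ] ℝ) volume

/-- The mollification of a function with vanishing weak gradient has vanishing gradient. -/
theorem hasFDerivAt_mollify_zero {f : Space N → ℝ} (hf : LocallyIntegrable f)
    (hweak : ∀ (ζ : 𝓓(Ω, ℝ)) (j : Fin N), ∫ x, partialDeriv j ζ x * f x = 0)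
    (b : ContDiffBump (0 : Space N)) {x : Space N}
    (hx : Metric.closedBall x b.rOut ⊆ (Ω : Set (Space N))) :
    HasFDerivAt (mollify b f) (0 : Space N →L[ℝ] ℝ) x := by
  set ρ : Space N → ℝ := b.normed volume with hρ
  have hρcd : ContDiff ℝ ∞ ρ := b.contDiff_normed
  have hρs : HasCompactSupport ρ := b.hasCompactSupport_normed
  have hd := hρs.hasFDerivAt_convolution_left (ContinuousLinearMap.lsmul ℝ ℝ : ℝ →L[ℝ] ℝ →L[ℝ] ℝ)
    (hρcd.of_le (by simp)) hf x
  have hζs : tsupport (fun z => ρ (x - z)) ⊆ Metric.closedBall x b.rOut := by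
    refine closure_minimal (fun z hz => ?_) Metric.isClosed_closedBall
    have hz' : x - z ∈ Function.support (b.normed volume) := hz
    rw [b.support_normed_eq, mem_ball_zero_iff] at hz'
    rw [Metric.mem_closedBall, dist_comm, dist_eq_norm]
    exact hz'.le
  -- Differentiating the mollification at `x` pairs `f` with minus the gradient of this admissible
  -- test function.
  let ζ : 𝓓(Ω, ℝ) := ⟨fun z => ρ (x - z), hρcd.comp (contDiff_const.sub contDiff_id),
    (isCompact_closedBall x b.rOut).of_isClosed_subset (isClosed_tsupport _) hζs, hζs.trans hx⟩
  have hζd : ∀ j z, partialDeriv j ζ z = -fderiv ℝ ρ (x - z) (basisVec j) := by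
    intro j z
    rw [partialDeriv_apply]
    have h1 : HasFDerivAt (fun z => x - z) (-ContinuousLinearMap.id ℝ (Space N)) z :=
      (hasFDerivAt_id z).const_sub x
    have h2 := ((hρcd.differentiable (by simp)) (x - z)).hasFDerivAt.comp z h1
    have h3 : fderiv ℝ ζ z = _ := h2.fderiv
    rw [h3]
    simp
  have hzero : convolution (fderiv ℝ ρ) f
      (ContinuousLinearMap.precompL (Space N) (ContinuousLinearMap.lsmul ℝ ℝ : ℝ →L[ℝ] ℝ →L[ℝ] ℝ)) volume x = 0 := by
    have hintg := (hρs.fderiv ℝ).convolutionExists_left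
      (ContinuousLinearMap.precompL (Space N) (ContinuousLinearMap.lsmul ℝ ℝ : ℝ →L[ℝ] ℝ →L[ℝ] ℝ))
      (hρcd.continuous_fderiv (by simp)) hf x
    have hbasis : ∀ j, convolution (fderiv ℝ ρ) f (ContinuousLinearMap.precompL (Space N)
        (ContinuousLinearMap.lsmul ℝ ℝ : ℝ →L[ℝ] ℝ →L[ℝ] ℝ)) volume x (basisVec j) = 0 := by
      intro j
      rw [convolution, ContinuousLinearMap.integral_apply hintg]
      have h := hweak ζ j
      rw [← integral_sub_left_eq_self _ volume x] at h
      rw [← neg_eq_zero, ← integral_neg, ← h]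
      refine integral_congr_ae (Eventually.of_forall fun t => ?_)
      simp [hζd, ContinuousLinearMap.precompL_apply]
    ext v
    rw [← sum_smul_basisVec v, map_sum]
    simp only [map_smul, hbasis]
    simp
  rw [hzero] at hd
  exact hd

/-- A measurable set whose indicator has vanishing weak gradient in a connected open set is, up to
null sets, all of it or empty. -/
theorem measure_diff_eq_zero_or_inter_eq_zero (hconn : IsPreconnected (Ω : Set (Space N)))
    {S : Set (Space N)} (hS : MeasurableSet S)
    (hweak : ∀ (ζ : 𝓓(Ω, ℝ)) (j : Fin N),
      ∫ x, partialDeriv j ζ x * S.indicator (fun _ => (1 : ℝ)) x = 0) :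
    volume ((Ω : Set (Space N)) \ S) = 0 ∨ volume ((Ω : Set (Space N)) ∩ S) = 0 := by
  set f : Space N → ℝ := S.indicator fun _ => 1 with hf
  have hfloc : LocallyIntegrable f := (locallyIntegrable_const 1).indicator hS
  -- The radii shrink with fixed ratio two, as a.e. convergence of the mollifications requires.
  let b : ℕ → ContDiffBump (0 : Space N) := fun n =>
    ⟨1 / (2 * ((n : ℝ) + 1)), 1 / ((n : ℝ) + 1), by positivity, by
      rw [one_div_lt_one_div (by positivity) (by positivity)]
      linarith [Nat.cast_nonneg (α := ℝ) n]⟩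
  have hb : Tendsto (fun n => (b n).rOut) atTop (𝓝 0) := tendsto_one_div_add_atTop_nhds_zero_nat
  have hae := ContDiffBump.ae_convolution_tendsto_right_of_locallyIntegrable (μ := volume)
    (K := 2) hb (Eventually.of_forall fun n => le_of_eq (by
      change 1 / ((n : ℝ) + 1) = 2 * (1 / (2 * ((n : ℝ) + 1)))
      field_simp)) hfloc
  have hae : volume {x | ¬ Tendsto (fun n => mollify (b n) f x) atTop (𝓝 (f x))} = 0 :=
    ae_iff.1 hae
  -- On a small ball the mollifications are eventually constant and converge a.e. to the indicator,
  -- which is thus a.e. constant there.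
  have hlocal : ∀ x ∈ (Ω : Set (Space N)), ∃ U, IsOpen U ∧ x ∈ U ∧
      (volume (U \ S) = 0 ∨ volume (U ∩ S) = 0) := by
    intro x hx
    obtain ⟨r, hr, hball⟩ := Metric.isOpen_iff.1 Ω.isOpen x hx
    set U := Metric.ball x (r / 2) with hU
    refine ⟨U, Metric.isOpen_ball, Metric.mem_ball_self (by positivity), ?_⟩
    have hconst : ∀ᶠ n in atTop, ∀ y ∈ U, ∀ z ∈ U,
        mollify (b n) f y =
          mollify (b n) f z := by
      filter_upwards [hb.eventually (gt_mem_nhds (half_pos hr))] with n hn y hy z hz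
      have hder : ∀ w ∈ U, HasFDerivAt (mollify (b n) f) (0 : Space N →L[ℝ] ℝ) w := by
        intro w hw
        refine hasFDerivAt_mollify_zero hfloc hweak (b n) fun v hv => hball ?_
        rw [Metric.mem_ball] at hw ⊢
        rw [Metric.mem_closedBall] at hv
        linarith [dist_triangle v w x]
      exact Metric.isOpen_ball.is_const_of_fderiv_eq_zero (𝕜 := ℝ)
        (convex_ball x (r / 2)).isPreconnected
        (fun w hw => (hder w hw).differentiableAt.differentiableWithinAt)
        (fun w hw => (hder w hw).fderiv) hy hz
    obtain ⟨y, hyU, hy⟩ : ∃ y ∈ U, Tendsto (fun n => mollify (b n) f y) atTop (𝓝 (f y)) := by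
      have hpos : volume U ≠ 0 := (Metric.measure_ball_pos volume x (half_pos hr)).ne'
      by_contra! hcon
      exact hpos (measure_mono_null (t := {x | ¬ Tendsto (fun n => mollify (b n) f x) atTop (𝓝 (f x))})
        (fun y hy => hcon y hy) hae)
    have hfy : ∀ z ∈ U, Tendsto (fun n => mollify (b n) f z) atTop (𝓝 (f z)) → f z = f y := by
      intro z hz hzt
      refine tendsto_nhds_unique hzt (hy.congr' ?_)
      filter_upwards [hconst] with n hn using hn y hyU z hz
    by_cases hyS : y ∈ S
    · left
      refine measure_mono_null (t := {x | ¬ Tendsto (fun n => mollify (b n) f x) atTop (𝓝 (f x))})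
        (fun z hz hzt => ?_) hae
      have := hfy z hz.1 hzt
      rw [hf, Set.indicator_of_mem hyS, Set.indicator_of_notMem hz.2] at this
      exact zero_ne_one this
    · right
      refine measure_mono_null (t := {x | ¬ Tendsto (fun n => mollify (b n) f x) atTop (𝓝 (f x))})
        (fun z hz hzt => ?_) hae
      have := hfy z hz.1 hzt
      rw [hf, Set.indicator_of_notMem hyS, Set.indicator_of_mem hz.2] at this
      exact one_ne_zero this
  set A := {x | ∃ U, IsOpen U ∧ x ∈ U ∧ volume (U \ S) = 0} with hA
  set B := {x | ∃ U, IsOpen U ∧ x ∈ U ∧ volume (U ∩ S) = 0} with hB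
  have hAo : IsOpen A := isOpen_iff_mem_nhds.2 fun x ⟨U, hU, hxU, h⟩ =>
    mem_of_superset (hU.mem_nhds hxU) fun y hy => ⟨U, hU, hy, h⟩
  have hBo : IsOpen B := isOpen_iff_mem_nhds.2 fun x ⟨U, hU, hxU, h⟩ =>
    mem_of_superset (hU.mem_nhds hxU) fun y hy => ⟨U, hU, hy, h⟩
  have hcover : (Ω : Set (Space N)) ⊆ A ∪ B := by
    intro x hx
    obtain ⟨U, hU, hxU, h | h⟩ := hlocal x hx
    · exact Or.inl ⟨U, hU, hxU, h⟩
    · exact Or.inr ⟨U, hU, hxU, h⟩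
  -- A point of both would have a null open neighbourhood.
  have hdisj : ∀ x, x ∈ A → x ∈ B → False := by
    rintro x ⟨U, hU, hxU, h⟩ ⟨W, hW, hxW, h'⟩
    refine ((hU.inter hW).measure_pos volume ⟨x, hxU, hxW⟩).ne' ?_
    refine measure_mono_null (t := U \ S ∪ W ∩ S) (fun z hz => ?_) (measure_union_null h h')
    by_cases hzS : z ∈ S
    · exact Or.inr ⟨hz.2, hzS⟩
    · exact Or.inl ⟨hz.1, hzS⟩
  have hsub : (Ω : Set (Space N)) ⊆ A ∨ (Ω : Set (Space N)) ⊆ B := by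
    refine isPreconnected_iff_subset_of_disjoint.1 hconn A B hAo hBo hcover ?_
    exact Set.eq_empty_iff_forall_notMem.2 fun x hx => hdisj x hx.2.1 hx.2.2
  refine hsub.imp (fun h => ?_) fun h => ?_
  · refine measure_null_of_locally_null _ fun x hx => ?_
    obtain ⟨U, hU, hxU, h0⟩ := h hx.1
    refine ⟨U ∩ ((Ω : Set (Space N)) \ S),
      inter_mem (mem_nhdsWithin_of_mem_nhds (hU.mem_nhds hxU)) self_mem_nhdsWithin,
      measure_mono_null (t := U \ S) (fun z hz => ⟨hz.1, hz.2.2⟩) h0⟩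
  · refine measure_null_of_locally_null _ fun x hx => ?_
    obtain ⟨U, hU, hxU, h0⟩ := h hx.1
    refine ⟨U ∩ ((Ω : Set (Space N)) ∩ S),
      inter_mem (mem_nhdsWithin_of_mem_nhds (hU.mem_nhds hxU)) self_mem_nhdsWithin,
      measure_mono_null (t := U ∩ S) (fun z hz => ⟨hz.1, hz.2.2⟩) h0⟩

end Connected

/-! ### Logarithmic gradient estimate -/

section Positivity

open Filter Topology

variable {N : ℕ} {Ω : Opens (Space N)}

/-- The pointwise product of two test functions. -/
noncomputable def mulTest (α β : 𝓓(Ω, ℝ)) : 𝓓(Ω, ℝ) :=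
  ⟨fun x => α x * β x, α.contDiff.mul β.contDiff, α.hasCompactSupport.mul_right,
    (tsupport_mul_subset_left).trans α.tsupport_subset⟩

theorem mulTest_apply (α β : 𝓓(Ω, ℝ)) (x : Space N) : mulTest α β x = α x * β x := rfl

/-- The test function `ζ / (χ + ε)`. -/
noncomputable def divTest (ζ χ : 𝓓(Ω, ℝ)) {ε : ℝ} (hε : 0 < ε) (hχ : ∀ x, 0 ≤ χ x) : 𝓓(Ω, ℝ) :=
  ⟨fun x => ζ x * (χ x + ε)⁻¹,
    ζ.contDiff.mul ((χ.contDiff.add contDiff_const).inv fun x => by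
      have := hχ x
      positivity),
    ζ.hasCompactSupport.mul_right, (tsupport_mul_subset_left).trans ζ.tsupport_subset⟩

theorem divTest_apply (ζ χ : 𝓓(Ω, ℝ)) {ε : ℝ} (hε : 0 < ε) (hχ : ∀ x, 0 ≤ χ x) (x : Space N) :
    divTest ζ χ hε hχ x = ζ x * (χ x + ε)⁻¹ := rfl

theorem inner_mulTest (a α β : 𝓓(Ω, ℝ)) :
    inner ℝ (testToL2 Ω ℝ α) (testToL2 Ω ℝ (mulTest a β)) =
      inner ℝ (testToL2 Ω ℝ (mulTest a α)) (testToL2 Ω ℝ β) := by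
  rw [inner_testToL2, inner_testToL2]
  refine integral_congr_ae ?_
  filter_upwards [coeFn_testToL2 α, coeFn_testToL2 (mulTest a α)] with x h1 h2
  rw [h1, h2, mulTest_apply, mulTest_apply]
  ring

theorem norm_mulTest_le {a : 𝓓(Ω, ℝ)} {A : ℝ} (ha : ∀ x, |a x| ≤ A) (β : 𝓓(Ω, ℝ)) :
    ‖testToL2 Ω ℝ (mulTest a β)‖ ≤ A * ‖testToL2 Ω ℝ β‖ := by
  refine Lp.norm_le_mul_norm_of_ae_le_mul ?_
  filter_upwards [coeFn_testToL2 β, coeFn_testToL2 (mulTest a β)] with x h1 h2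
  rw [h1, h2, mulTest_apply, norm_mul]
  exact mul_le_mul_of_nonneg_right (ha x) (norm_nonneg _)

/-- The quotient rule for `ζ² / (χ + ε)`, factored through `a = ζ / (χ + ε)`: moving one `a` across
the inner product with `∂χ` produces `‖a ∂χ‖²`. -/
theorem partialDeriv_mulTest_divTest (ζ χ : 𝓓(Ω, ℝ)) {ε : ℝ} (hε : 0 < ε) (hχ : ∀ x, 0 ≤ χ x)
    (j : Fin N) : partialDeriv j (mulTest ζ (divTest ζ χ hε hχ)) =
      (2 : ℝ) • mulTest (divTest ζ χ hε hχ) (partialDeriv j ζ) -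
        mulTest (divTest ζ χ hε hχ) (mulTest (divTest ζ χ hε hχ) (partialDeriv j χ)) := by
  ext x
  have hne : χ x + ε ≠ 0 := by
    have := hχ x
    positivity
  have hζ := (differentiable_testFunction ζ x).hasFDerivAt
  have hχd := (differentiable_testFunction χ x).hasFDerivAt
  have h1 := hζ.mul (hζ.mul ((hasDerivAt_inv hne).comp_hasFDerivAt x (hχd.add_const ε)))
  have h2 : fderiv ℝ (mulTest ζ (divTest ζ χ hε hχ)) x = _ := h1.fderiv
  rw [partialDeriv_apply, h2]
  change _ = 2 * (ζ x * (χ x + ε)⁻¹ * partialDeriv j ζ x) -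
    ζ x * (χ x + ε)⁻¹ * (ζ x * (χ x + ε)⁻¹ * partialDeriv j χ x)
  rw [partialDeriv_apply, partialDeriv_apply]
  simp
  field_simp
  ring

/-- The logarithmic Caccioppoli estimate for a supersolution `φ` and a test function `χ` which
approximates it. -/
theorem sum_norm_sq_log_gradient_le {l : ℝ} (hl : 0 ≤ l) {φ : L2 Ω ℝ} {g : Fin N → L2 Ω ℝ}
    (hEL : ∀ q ∈ H10 Ω ℝ, ∑ j, inner ℝ (g j) (q.2 j) = inner ℝ (l • φ) q.1)
    (hφ : ∀ᵐ x ∂(volume.restrict (Ω : Set (Space N))), 0 ≤ φ x) (ζ χ : 𝓓(Ω, ℝ)) {ε : ℝ}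
    (hε : 0 < ε) (hχ : ∀ x, 0 ≤ χ x) {A : ℝ} (hA : ∀ x, |divTest ζ χ hε hχ x| ≤ A) :
    ∑ j, ‖testToL2 Ω ℝ (mulTest (divTest ζ χ hε hχ) (partialDeriv j χ))‖ ^ 2 ≤
      4 * energy (testWithGradient Ω ℝ ζ) +
        2 * ∑ j, ‖testToL2 Ω ℝ (partialDeriv j χ) - g j‖ *
          (2 * (A * ‖testToL2 Ω ℝ (partialDeriv j ζ)‖) +
            A * (A * ‖testToL2 Ω ℝ (partialDeriv j χ)‖)) := by
  set a := divTest ζ χ hε hχ with ha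
  have hA0 : 0 ≤ A := (abs_nonneg _).trans (hA 0)
  -- The test function `ζ² / (χ + ε)` is built from the smooth `χ`, not from `φ`. The price is the
  -- error term in `∂χ - g`.
  have hsol := hEL _ (testWithGradient_mem_H10 Ω ℝ (mulTest ζ a))
  have hnn : 0 ≤ inner ℝ (l • φ) (testToL2 Ω ℝ (mulTest ζ a)) := by
    rw [real_inner_smul_left, inner_testToL2]
    refine mul_nonneg hl (integral_nonneg_of_ae ?_)
    filter_upwards [hφ] with x hx
    have h1 : 0 ≤ χ x + ε := add_nonneg (hχ x) hε.le
    have h2 : mulTest ζ a x = ζ x ^ 2 * (χ x + ε)⁻¹ := by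
      rw [mulTest_apply, ha, divTest_apply]
      ring
    rw [h2]
    simp only [Pi.zero_apply]
    positivity
  have hterm : ∀ j, ‖testToL2 Ω ℝ (mulTest a (partialDeriv j χ))‖ ^ 2 ≤
      4 * ‖testToL2 Ω ℝ (partialDeriv j ζ)‖ ^ 2 +
        2 * (‖testToL2 Ω ℝ (partialDeriv j χ) - g j‖ *
          (2 * (A * ‖testToL2 Ω ℝ (partialDeriv j ζ)‖) +
            A * (A * ‖testToL2 Ω ℝ (partialDeriv j χ)‖))) -
        2 * inner ℝ (g j) (testToL2 Ω ℝ (partialDeriv j (mulTest ζ a))) := by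
    intro j
    set w := testToL2 Ω ℝ (mulTest a (partialDeriv j χ)) with hw
    set z := testToL2 Ω ℝ (partialDeriv j ζ)
    set v := testToL2 Ω ℝ (partialDeriv j (mulTest ζ a)) with hv
    have hv' : v = (2 : ℝ) • testToL2 Ω ℝ (mulTest a (partialDeriv j ζ)) -
        testToL2 Ω ℝ (mulTest a (mulTest a (partialDeriv j χ))) := by
      rw [hv, ha, partialDeriv_mulTest_divTest, map_sub, map_smul]
    have h1 : inner ℝ (testToL2 Ω ℝ (partialDeriv j χ)) v = 2 * inner ℝ w z - ‖w‖ ^ 2 := by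
      rw [hv', inner_sub_right, real_inner_smul_right, inner_mulTest, inner_mulTest,
        ← real_inner_self_eq_norm_sq]
    have h2 : ‖v‖ ≤ 2 * (A * ‖z‖) + A * (A * ‖testToL2 Ω ℝ (partialDeriv j χ)‖) := by
      rw [hv']
      refine (norm_sub_le _ _).trans (add_le_add ?_ ?_)
      · rw [norm_smul, Real.norm_two]
        exact mul_le_mul_of_nonneg_left (norm_mulTest_le hA _) zero_le_two
      · exact (norm_mulTest_le hA _).trans
          (mul_le_mul_of_nonneg_left (norm_mulTest_le hA _) hA0)
    have h3 : -(‖testToL2 Ω ℝ (partialDeriv j χ) - g j‖ *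
        (2 * (A * ‖z‖) + A * (A * ‖testToL2 Ω ℝ (partialDeriv j χ)‖))) ≤
        inner ℝ (testToL2 Ω ℝ (partialDeriv j χ) - g j) v := by
      refine le_trans (neg_le_neg ?_) (neg_abs_le _)
      exact (abs_real_inner_le_norm _ _).trans (mul_le_mul_of_nonneg_left h2 (norm_nonneg _))
    rw [inner_sub_left, h1] at h3
    -- Young's inequality, leaving half of `‖w‖²` to be absorbed on the left.
    have h4 : 2 * inner ℝ w z ≤ ‖w‖ ^ 2 / 2 + 2 * ‖z‖ ^ 2 := by
      nlinarith [real_inner_le_norm w z, sq_nonneg (‖w‖ - 2 * ‖z‖)]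
    linarith
  have hsum := Finset.sum_le_sum fun j (_ : j ∈ Finset.univ) => hterm j
  rw [Finset.sum_sub_distrib, Finset.sum_add_distrib, ← Finset.mul_sum, ← Finset.mul_sum,
    ← Finset.mul_sum] at hsum
  have hsol' : ∑ j, inner ℝ (g j) (testToL2 Ω ℝ (partialDeriv j (mulTest ζ a))) =
      inner ℝ (l • φ) (testToL2 Ω ℝ (mulTest ζ a)) := hsol
  have hen : energy (testWithGradient Ω ℝ ζ) = ∑ j, ‖testToL2 Ω ℝ (partialDeriv j ζ)‖ ^ 2 := rfl
  rw [hen]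
  linarith

/-- The truncated logarithm `log (1 + t⁺ / ε)`. -/
noncomputable def logTrunc (ε t : ℝ) : ℝ := Real.log (max t 0 + ε) - Real.log ε

theorem logTrunc_zero (ε : ℝ) : logTrunc ε 0 = 0 := by simp [logTrunc]

/-- The logarithm has slope at most `1 / ε` on `[ε, ∞)`. Being Lipschitz, the truncation acts
continuously on `L²`, so estimates pass from `χ n` to `φ`. -/
theorem lipschitzWith_logTrunc {ε : ℝ} (hε : 0 < ε) :
    LipschitzWith ε⁻¹.toNNReal (logTrunc ε) := by
  have key : ∀ a b : ℝ, ε ≤ a → ε ≤ b → Real.log a - Real.log b ≤ ε⁻¹ * |a - b| := by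
    intro a b ha hb
    have ha0 := hε.trans_le ha
    have hb0 := hε.trans_le hb
    rw [← Real.log_div ha0.ne' hb0.ne']
    refine (Real.log_le_sub_one_of_pos (div_pos ha0 hb0)).trans ?_
    have : a / b - 1 = b⁻¹ * (a - b) := by field_simp
    rw [this]
    refine (mul_le_mul_of_nonneg_left (le_abs_self _) (inv_pos.2 hb0).le).trans ?_
    exact mul_le_mul_of_nonneg_right (inv_anti₀ hε hb) (abs_nonneg _)
  refine LipschitzWith.of_dist_le_mul fun s t => ?_
  rw [Real.coe_toNNReal _ (inv_pos.2 hε).le, Real.dist_eq, Real.dist_eq, logTrunc, logTrunc,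
    sub_sub_sub_cancel_right]
  have hs : ε ≤ max s 0 + ε := by linarith [le_max_right s 0]
  have ht : ε ≤ max t 0 + ε := by linarith [le_max_right t 0]
  have hmax : |max s 0 + ε - (max t 0 + ε)| ≤ |s - t| := by
    rw [add_sub_add_right_eq_sub]
    exact abs_max_sub_max_le_abs s t 0
  have h1 := key _ _ hs ht
  have h2 := key _ _ ht hs
  rw [abs_sub_comm] at h2
  have h3 := mul_le_mul_of_nonneg_left hmax (inv_pos.2 hε).le
  exact abs_le.2 ⟨by linarith, by linarith⟩

/-- Integration by parts against `log (1 + χ / ε)`. -/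
theorem inner_partialDeriv_logTrunc (ζ χ : 𝓓(Ω, ℝ)) {ε : ℝ} (hε : 0 < ε) (hχ : ∀ x, 0 ≤ χ x)
    (j : Fin N) :
    inner ℝ ((lipschitzWith_logTrunc hε).compLp (logTrunc_zero ε) (testToL2 Ω ℝ χ))
      (testToL2 Ω ℝ (partialDeriv j ζ)) =
      - ∫ x in (Ω : Set (Space N)), mulTest (divTest ζ χ hε hχ) (partialDeriv j χ) x := by
  have hne : ∀ x, χ x + ε ≠ 0 := fun x => (add_pos_of_nonneg_of_pos (hχ x) hε).ne'
  set L : Space N → ℝ := fun x => Real.log (χ x + ε) - Real.log ε with hL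
  have hLd : ∀ x, HasFDerivAt L ((χ x + ε)⁻¹ • fderiv ℝ χ x) x := fun x =>
    (((differentiable_testFunction χ x).hasFDerivAt.add_const ε).log (hne x)).sub_const _
  have hLc : Continuous L := continuous_iff_continuousAt.2 fun x => (hLd x).continuousAt
  have hLi : ∀ β : 𝓓(Ω, ℝ), Integrable fun x => L x * β x := fun β =>
    Continuous.integrable_of_hasCompactSupport (hLc.mul β.continuous)
      (HasCompactSupport.mul_left β.hasCompactSupport)
  have hibp : ∫ x, L x * partialDeriv j ζ x =
      - ∫ x, mulTest (divTest ζ χ hε hχ) (partialDeriv j χ) x := by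
    have hw : ∀ x, fderiv ℝ L x (basisVec j) * ζ x =
        mulTest (divTest ζ χ hε hχ) (partialDeriv j χ) x := by
      intro x
      rw [(hLd x).fderiv, mulTest_apply, divTest_apply, partialDeriv_apply]
      simp only [smul_apply, smul_eq_mul]
      ring
    have := integral_mul_fderiv_eq_neg_fderiv_mul_of_integrable (μ := volume) (f := L) (g := ζ)
      (v := basisVec j) ?_ ?_ ?_ (fun x _ => (hLd x).differentiableAt)
      (fun x _ => differentiable_testFunction ζ x)
    · simp only [hw, ← partialDeriv_apply] at this
      exact this
    · simp only [hw]
      exact Continuous.integrable_of_hasCompactSupport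
        (mulTest (divTest ζ χ hε hχ) (partialDeriv j χ)).continuous
        (mulTest (divTest ζ χ hε hχ) (partialDeriv j χ)).hasCompactSupport
    · simp only [← partialDeriv_apply]
      exact hLi (partialDeriv j ζ)
    · exact hLi ζ
  rw [inner_testToL2, setIntegral_eq_integral_of_forall_compl_eq_zero
    (fun x hx => testFunction_eq_zero _ hx), ← hibp,
    ← setIntegral_eq_integral_of_forall_compl_eq_zero (s := (Ω : Set (Space N)))
      (f := fun x => L x * partialDeriv j ζ x)
      (fun x hx => by rw [testFunction_eq_zero _ hx, mul_zero])]
  refine integral_congr_ae ?_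
  filter_upwards [coeFn_testToL2 χ, (lipschitzWith_logTrunc hε).coeFn_compLp (logTrunc_zero ε)
    (testToL2 Ω ℝ χ)] with x h1 h2
  rw [h2, Function.comp_apply, h1, logTrunc, max_eq_left (hχ x)]

/-- A bound, uniform in `ε`, for the weak gradient of `log (1 + φ / ε)`. -/
theorem abs_inner_logTrunc_le (hbdd : Bornology.IsBounded (Ω : Set (Space N))) {l : ℝ}
    (hl : 0 ≤ l) {p : L2 Ω ℝ × (Fin N → L2 Ω ℝ)}
    (hEL : ∀ q ∈ H10 Ω ℝ, ∑ j, inner ℝ (p.2 j) (q.2 j) = inner ℝ (l • p.1) q.1)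
    (hφ : ∀ᵐ x ∂(volume.restrict (Ω : Set (Space N))), 0 ≤ p.1 x) {χ : ℕ → 𝓓(Ω, ℝ)}
    (hχ : ∀ n x, 0 ≤ χ n x) (hlim : Tendsto (fun n => testWithGradient Ω ℝ (χ n)) atTop (𝓝 p))
    (ζ : 𝓓(Ω, ℝ)) (j : Fin N) : ∃ C : ℝ, ∀ (ε : ℝ) (hε : 0 < ε),
      |inner ℝ ((lipschitzWith_logTrunc hε).compLp (logTrunc_zero ε) p.1)
        (testToL2 Ω ℝ (partialDeriv j ζ))| ≤ C := by
  have : IsFiniteMeasure (volume.restrict (Ω : Set (Space N))) :=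
    ⟨by simpa using hbdd.measure_lt_top⟩
  have hone : MemLp (fun _ : Space N => (1 : ℝ)) 2 (volume.restrict (Ω : Set (Space N))) :=
    memLp_const 1
  -- The factor `‖1‖` comes from Cauchy–Schwarz on `Ω`, the root from the logarithmic estimate.
  -- Powers of `1 / ε` occur only in the error term, which vanishes as `n → ∞` with `ε` fixed.
  refine ⟨‖hone.toLp‖ * Real.sqrt (4 * energy (testWithGradient Ω ℝ ζ)), fun ε hε => ?_⟩
  obtain ⟨A, hA⟩ : ∃ A, ∀ x, |ζ x| ≤ A := by
    obtain ⟨A, hA⟩ := ζ.hasCompactSupport.exists_bound_of_continuous ζ.continuous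
    exact ⟨A, hA⟩
  have hA' : ∀ n x, |divTest ζ (χ n) hε (hχ n) x| ≤ A * ε⁻¹ := by
    intro n x
    have h0 : 0 < χ n x + ε := add_pos_of_nonneg_of_pos (hχ n x) hε
    rw [divTest_apply, abs_mul, abs_of_pos (inv_pos.2 h0)]
    exact mul_le_mul (hA x) (inv_anti₀ hε (by linarith [hχ n x])) (inv_pos.2 h0).le
      ((abs_nonneg _).trans (hA x))
  have hgrad : ∀ i, Tendsto (fun n => testToL2 Ω ℝ (partialDeriv i (χ n))) atTop (𝓝 (p.2 i)) :=
    fun i => ((continuous_apply i).tendsto _).comp ((continuous_snd.tendsto _).comp hlim)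
  have hfst : Tendsto (fun n => testToL2 Ω ℝ (χ n)) atTop (𝓝 p.1) :=
    (continuous_fst.tendsto _).comp hlim
  have hleft : Tendsto (fun n => |inner ℝ ((lipschitzWith_logTrunc hε).compLp (logTrunc_zero ε)
      (testToL2 Ω ℝ (χ n))) (testToL2 Ω ℝ (partialDeriv j ζ))|) atTop
      (𝓝 |inner ℝ ((lipschitzWith_logTrunc hε).compLp (logTrunc_zero ε) p.1)
        (testToL2 Ω ℝ (partialDeriv j ζ))|) :=
    (((((lipschitzWith_logTrunc hε).continuous_compLp (logTrunc_zero ε)).tendsto _).comp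
      hfst).inner tendsto_const_nhds).abs
  have herr : Tendsto (fun n => 4 * energy (testWithGradient Ω ℝ ζ) +
      2 * ∑ i, ‖testToL2 Ω ℝ (partialDeriv i (χ n)) - p.2 i‖ *
        (2 * (A * ε⁻¹ * ‖testToL2 Ω ℝ (partialDeriv i ζ)‖) +
          A * ε⁻¹ * (A * ε⁻¹ * ‖testToL2 Ω ℝ (partialDeriv i (χ n))‖))) atTop
      (𝓝 (4 * energy (testWithGradient Ω ℝ ζ) + 2 * ∑ i, ‖p.2 i - p.2 i‖ *
        (2 * (A * ε⁻¹ * ‖testToL2 Ω ℝ (partialDeriv i ζ)‖) +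
          A * ε⁻¹ * (A * ε⁻¹ * ‖p.2 i‖)))) := by
    refine Tendsto.const_add _ (Tendsto.const_mul _ (tendsto_finsetSum _ fun i _ => ?_))
    exact ((hgrad i).sub_const _).norm.mul
      ((((hgrad i).norm.const_mul _).const_mul _).const_add _)
  simp only [sub_self, norm_zero, zero_mul, Finset.sum_const_zero, mul_zero, add_zero] at herr
  refine le_of_tendsto_of_tendsto' hleft (herr.sqrt.const_mul ‖hone.toLp‖) fun n => ?_
  rw [inner_partialDeriv_logTrunc ζ (χ n) hε (hχ n) j, abs_neg]
  have hintg : ∫ x in (Ω : Set (Space N)),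
      mulTest (divTest ζ (χ n) hε (hχ n)) (partialDeriv j (χ n)) x =
      inner ℝ hone.toLp
        (testToL2 Ω ℝ (mulTest (divTest ζ (χ n) hε (hχ n)) (partialDeriv j (χ n)))) := by
    rw [inner_testToL2]
    refine integral_congr_ae ?_
    filter_upwards [hone.coeFn_toLp] with x hx
    rw [hx, one_mul]
  rw [hintg]
  refine (abs_real_inner_le_norm _ _).trans (mul_le_mul_of_nonneg_left ?_ (norm_nonneg _))
  refine Real.le_sqrt_of_sq_le (le_trans ?_
    (sum_norm_sq_log_gradient_le hl hEL hφ ζ (χ n) hε (hχ n) (hA' n)))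
  exact Finset.single_le_sum
    (f := fun i => ‖testToL2 Ω ℝ
      (mulTest (divTest ζ (χ n) hε (hχ n)) (partialDeriv i (χ n)))‖ ^ 2)
    (fun _ _ => sq_nonneg _) (Finset.mem_univ j)

end Positivity

/-! ### Reduction of the system to linear algebra -/

section System

variable {N M : ℕ} {Ω : Opens (Space N)}

/-- The `i`-th component of a vector-valued `L²` function. -/
noncomputable def component (i : Fin M) (u : L2 Ω (Space M)) : L2 Ω ℝ :=
  (EuclideanSpace.proj i : Space M →L[ℝ] ℝ).compLp u

theorem coeFn_component (i : Fin M) (u : L2 Ω (Space M)) :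
    ∀ᵐ x ∂(volume.restrict (Ω : Set (Space N))), component i u x = u x i :=
  (EuclideanSpace.proj i : Space M →L[ℝ] ℝ).coeFn_compLp u

/-- The vector-valued `L²` function whose only nonzero component is the `i`-th one. -/
noncomputable def single (i : Fin M) (f : L2 Ω ℝ) : L2 Ω (Space M) :=
  (ContinuousLinearMap.toSpanSingleton ℝ (EuclideanSpace.single i (1 : ℝ))).compLp f

theorem inner_single (i : Fin M) (u : L2 Ω (Space M)) (f : L2 Ω ℝ) :
    inner ℝ u (single i f) = inner ℝ (component i u) f := by
  rw [L2.inner_def, L2.inner_def]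
  refine integral_congr_ae ?_
  filter_upwards [coeFn_component i u, (ContinuousLinearMap.toSpanSingleton ℝ
    (EuclideanSpace.single i (1 : ℝ))).coeFn_compLp f] with x h1 h2
  rw [h1, single, h2]
  simp [inner_smul_right, EuclideanSpace.inner_single_right]

/-- Testing `A u = f` with a scalar eigenfunction in the `i`-th component. -/
theorem inner_component_eigenfunction {φ : L2 Ω ℝ} {l : ℝ} (hφ : (φ, l • φ) ∈ laplacianGraph Ω ℝ)
    {u f : L2 Ω (Space M)} (hu : (u, f) ∈ laplacianGraph Ω (Space M)) (i : Fin M) :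
    inner ℝ (component i f) φ = l * inner ℝ (component i u) φ := by
  obtain ⟨g, hg, hg'⟩ := hφ
  obtain ⟨G, hG, hG'⟩ := hu
  -- Each equation is tested with the other's solution: the system with `φ` in the `i`-th slot, the
  -- scalar equation with the `i`-th component of `u`. The gradient pairings coincide.
  have h1 := hG' _ (compLp_mem_H10
    (ContinuousLinearMap.toSpanSingleton ℝ (EuclideanSpace.single i (1 : ℝ))) hg)
  have h2 := hg' _ (compLp_mem_H10 (EuclideanSpace.proj i : Space M →L[ℝ] ℝ) hG)
  change ∑ j, inner ℝ (G j) (single i (g j)) = inner ℝ f (single i φ) at h1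
  change ∑ j, inner ℝ (g j) (component i (G j)) = inner ℝ (l • φ) (component i u) at h2
  simp only [inner_single] at h1
  rw [← h1, real_inner_comm φ, ← real_inner_smul_left, ← h2]
  exact Finset.sum_congr rfl fun j _ => real_inner_comm _ _

/-- `D` is constant in `x`, so it commutes with pairing against `φ`. -/
theorem inner_component_nemytskii (D : Matrix (Fin M) (Fin M) ℝ) (u : L2 Ω (Space M))
    (φ : L2 Ω ℝ) (i : Fin M) :
    inner ℝ (component i (nemytskii Ω D u)) φ =
      D.mulVec (fun j => inner ℝ (component j u) φ) i := by
  have h : component i (nemytskii Ω D u) = ∑ j, D i j • component j u := by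
    ext1
    have h0 : ∀ᵐ x ∂(volume.restrict (Ω : Set (Space N))),
        nemytskii Ω D u x = Matrix.toEuclideanCLM (𝕜 := ℝ) D (u x) :=
      (Matrix.toEuclideanCLM (𝕜 := ℝ) D).coeFn_compLp u
    have h1 : ∀ᵐ x ∂(volume.restrict (Ω : Set (Space N))), ∀ j, component j u x = u x j :=
      ae_all_iff.2 fun j => coeFn_component j u
    have h2 : ∀ᵐ x ∂(volume.restrict (Ω : Set (Space N))), ∀ j,
        (D i j • component j u : L2 Ω ℝ) x = D i j * component j u x :=
      ae_all_iff.2 fun j => Lp.coeFn_smul _ _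
    have h3 := Lp.coeFn_finsetSum Finset.univ fun j => D i j • component j u
    filter_upwards [h0, h1, h2, coeFn_component i (nemytskii Ω D u), h3]
      with x h0 h1 h2 h4 h3
    rw [h4, h0, h3, Finset.sum_apply]
    simp only [h2, h1]
    rfl
  rw [h, sum_inner]
  simp only [real_inner_smul_left]
  rfl

theorem inner_nonneg_of_ae_nonneg {f g : L2 Ω ℝ}
    (hf : ∀ᵐ x ∂(volume.restrict (Ω : Set (Space N))), 0 ≤ f x)
    (hg : ∀ᵐ x ∂(volume.restrict (Ω : Set (Space N))), 0 ≤ g x) : 0 ≤ inner ℝ f g := by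
  rw [L2.inner_def]
  refine integral_nonneg_of_ae ?_
  filter_upwards [hf, hg] with x h1 h2
  exact mul_nonneg h2 h1

theorem eq_zero_of_inner_pos_eq_zero {f φ : L2 Ω ℝ}
    (hf : ∀ᵐ x ∂(volume.restrict (Ω : Set (Space N))), 0 ≤ f x)
    (hφ : ∀ᵐ x ∂(volume.restrict (Ω : Set (Space N))), 0 < φ x) (h : inner ℝ f φ = 0) :
    ∀ᵐ x ∂(volume.restrict (Ω : Set (Space N))), f x = 0 := by
  rw [L2.inner_def, integral_eq_zero_iff_of_nonneg_ae _ (L2.integrable_inner f φ)] at h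
  · filter_upwards [h, hφ] with x h1 h2
    have h1 : φ x * f x = 0 := h1
    exact (mul_eq_zero.1 h1).resolve_left h2.ne'
  · filter_upwards [hf, hφ] with x h1 h2
    exact mul_nonneg h2.le h1

theorem mem_solutions_iff {D : Matrix (Fin M) (Fin M) ℝ} {w u : L2 Ω (Space M)} :
    u ∈ solutions Ω D w ↔ (u, nemytskii Ω D u + w) ∈ laplacianGraph Ω (Space M) := by
  rw [← dirichletLaplacian_graph, LinearPMap.mem_graph_iff]
  constructor
  · rintro ⟨hu, h⟩
    exact ⟨⟨u, hu⟩, rfl, by rw [← h]; exact (add_sub_cancel _ _).symm⟩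
  · rintro ⟨⟨y, hy⟩, rfl, h⟩
    exact ⟨hy, by rw [h]; exact add_sub_cancel_left _ _⟩

/-- The conclusion for the system, given a positive scalar eigenfunction for `l`. -/
theorem solutions_inter_cone_of_pos_eigenfunction (hM : 0 < M) {l : ℝ} {φ : L2 Ω ℝ}
    (hφ : (φ, l • φ) ∈ laplacianGraph Ω ℝ) (hφ0 : φ ≠ 0)
    (hpos : ∀ᵐ x ∂(volume.restrict (Ω : Set (Space N))), 0 < φ x)
    {D : Matrix (Fin M) (Fin M) ℝ} (hD : QuasiNonneg D) (hσ : l ∉ sigmaPlus D) :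
    solutions Ω D 0 ∩ cone Ω M = {0} ∧
      (l < spectralBound D → ∃ w ∈ cone Ω M, solutions Ω D w ∩ cone Ω M = ∅) := by
  have hnn : ∀ᵐ x ∂(volume.restrict (Ω : Set (Space N))), 0 ≤ φ x := by
    filter_upwards [hpos] with x hx using hx.le
  have hcone : ∀ u ∈ cone Ω M, ∀ i,
      ∀ᵐ x ∂(volume.restrict (Ω : Set (Space N))), 0 ≤ component i u x := by
    intro u hu i
    filter_upwards [hu, coeFn_component i u] with x h1 h2
    rw [h2]
    exact h1 i
  have key : ∀ w, ∀ u ∈ solutions Ω D w, ∀ i, D.mulVec (fun j => inner ℝ (component j u) φ) i +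
      inner ℝ (component i w) φ = l * inner ℝ (component i u) φ := by
    intro w u hu i
    rw [← inner_component_eigenfunction hφ (mem_solutions_iff.1 hu) i,
      ← inner_component_nemytskii, ← inner_add_left]
    congr 1
    exact (((EuclideanSpace.proj i : Space M →L[ℝ] ℝ).compLpL 2
      (volume.restrict (Ω : Set (Space N)))).map_add (nemytskii Ω D u) w).symm
  have hc0 : ∀ i, component i (0 : L2 Ω (Space M)) = 0 := fun i =>
    ((EuclideanSpace.proj i : Space M →L[ℝ] ℝ).compLpL 2
      (volume.restrict (Ω : Set (Space N)))).map_zero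
  constructor
  · refine Set.eq_singleton_iff_unique_mem.2 ⟨⟨mem_solutions_iff.2 ?_, ?_⟩, ?_⟩
    · rw [map_zero, add_zero]
      exact (laplacianGraph Ω (Space M)).zero_mem
    · filter_upwards [Lp.coeFn_zero (Space M) 2 (volume.restrict (Ω : Set (Space N)))] with x hx i
      rw [hx]
      rfl
    · rintro u ⟨hu, huK⟩
      have hv : (fun j => inner ℝ (component j u) φ) = (0 : Fin M → ℝ) := by
        by_contra hv
        refine hσ ⟨_, hv, fun i => inner_nonneg_of_ae_nonneg (hcone u huK i) hnn, ?_⟩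
        funext i
        have h1 := key 0 u hu i
        rw [hc0, inner_zero_left, add_zero] at h1
        exact h1
      have h0 : ∀ᵐ x ∂(volume.restrict (Ω : Set (Space N))), ∀ i, component i u x = 0 :=
        ae_all_iff.2 fun i =>
          eq_zero_of_inner_pos_eq_zero (hcone u huK i) hpos (congrFun hv i)
      rw [Lp.eq_zero_iff_ae_eq_zero]
      filter_upwards [h0, ae_all_iff.2 fun i => coeFn_component i u] with x h1 h2
      ext i
      rw [← h2, h1]
      rfl
  · intro hl
    -- All components of `w` equal `φ`, so each row of the moment identity gains `‖φ‖² > 0`.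
    let w : L2 Ω (Space M) := (ContinuousLinearMap.toSpanSingleton ℝ
      (WithLp.toLp 2 fun _ : Fin M => (1 : ℝ))).compLp φ
    have hw : ∀ᵐ x ∂(volume.restrict (Ω : Set (Space N))), ∀ i, w x i = φ x := by
      filter_upwards [(ContinuousLinearMap.toSpanSingleton ℝ
        (WithLp.toLp 2 fun _ : Fin M => (1 : ℝ))).coeFn_compLp φ] with x hx i
      rw [hx]
      simp
    have hwc : ∀ i, component i w = φ := by
      intro i
      ext1
      filter_upwards [hw, coeFn_component i w] with x h1 h2
      rw [h2, h1]
    refine ⟨w, ?_, Set.eq_empty_iff_forall_notMem.2 ?_⟩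
    · filter_upwards [hw, hnn] with x h1 h2 i
      rw [h1]
      exact h2
    · rintro u ⟨hu, huK⟩
      refine absurd hl (not_lt.2 (spectralBound_le_of_mulVec_lt hM hD
        (fun i => inner_nonneg_of_ae_nonneg (hcone u huK i) hnn) fun i => ?_))
      rw [← key w u hu i, hwc]
      exact lt_add_of_pos_right _ (real_inner_self_pos.2 hφ0)

end System

/-! ### Almost everywhere positivity of the first eigenfunction -/

section StrongMaximumPrinciple

open Filter Topology

variable {N : ℕ} {Ω : Opens (Space N)}

theorem logTrunc_exp_neg {k t : ℝ} (ht : 0 ≤ t) :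
    logTrunc (Real.exp (-k)) t = Real.log (t + Real.exp (-k)) + k := by
  rw [logTrunc, max_eq_left ht, Real.log_exp, sub_neg_eq_add]

/-- The numerator lies between `0` and `t + k`, since `log x ≤ x - 1`. Uniformity in `k` supplies
the majorant for dominated convergence. -/
theorem abs_logTrunc_exp_neg_div_le {k t : ℝ} (hk : 1 ≤ k) (ht : 0 ≤ t) :
    |logTrunc (Real.exp (-k)) t / k| ≤ 1 + t := by
  have hk0 : 0 < k := by linarith
  have he := Real.exp_pos (-k)
  have he1 : Real.exp (-k) ≤ 1 := Real.exp_le_one_iff.2 (by linarith)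
  have h1 : -k ≤ Real.log (t + Real.exp (-k)) := by
    conv_lhs => rw [← Real.log_exp (-k)]
    exact Real.log_le_log he (by linarith)
  have h2 := Real.log_le_sub_one_of_pos (add_pos_of_nonneg_of_pos ht he)
  rw [logTrunc_exp_neg ht, abs_of_nonneg (div_nonneg (by linarith) hk0.le), div_le_iff₀ hk0]
  nlinarith

/-- For `t > 0` the term `log (t + exp (-k))` converges, so after division by `k` only the summand
`k` survives; at `t = 0` everything is zero. -/
theorem tendsto_logTrunc_exp_neg_div {t : ℝ} (ht : 0 ≤ t) :
    Tendsto (fun n : ℕ => logTrunc (Real.exp (-((n : ℝ) + 1))) t / ((n : ℝ) + 1)) atTop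
      (𝓝 ((Set.Ioi (0 : ℝ)).indicator (fun _ => 1) t)) := by
  rcases ht.eq_or_lt with rfl | hpos
  · simp [logTrunc_zero]
  · rw [Set.indicator_of_mem (Set.mem_Ioi.2 hpos)]
    have hn : Tendsto (fun n : ℕ => (n : ℝ) + 1) atTop atTop :=
      tendsto_natCast_atTop_atTop.atTop_add tendsto_const_nhds
    have he : Tendsto (fun n : ℕ => t + Real.exp (-((n : ℝ) + 1))) atTop (𝓝 (t + 0)) :=
      (Real.tendsto_exp_neg_atTop_nhds_zero.comp hn).const_add t
    have hlog := he.log (by linarith)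
    have hdiv := (hlog.div_atTop hn).add_const 1
    rw [zero_add] at hdiv
    refine hdiv.congr fun n => ?_
    have : (n : ℝ) + 1 ≠ 0 := by positivity
    rw [logTrunc_exp_neg ht, add_div, div_self this]

/-- The positivity set of a supersolution has vanishing weak gradient. -/
theorem integral_partialDeriv_indicator_eq_zero
    (hbdd : Bornology.IsBounded (Ω : Set (Space N))) {l : ℝ}
    (hl : 0 ≤ l) {p : L2 Ω ℝ × (Fin N → L2 Ω ℝ)}
    (hEL : ∀ q ∈ H10 Ω ℝ, ∑ j, inner ℝ (p.2 j) (q.2 j) = inner ℝ (l • p.1) q.1)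
    (hφ : ∀ᵐ x ∂(volume.restrict (Ω : Set (Space N))), 0 ≤ p.1 x) {χ : ℕ → 𝓓(Ω, ℝ)}
    (hχ : ∀ n x, 0 ≤ χ n x) (hlim : Tendsto (fun n => testWithGradient Ω ℝ (χ n)) atTop (𝓝 p))
    (ζ : 𝓓(Ω, ℝ)) (j : Fin N) :
    ∫ x, partialDeriv j ζ x * {x | 0 < p.1 x}.indicator (fun _ => (1 : ℝ)) x = 0 := by
  obtain ⟨C, hC⟩ := abs_inner_logTrunc_le hbdd hl hEL hφ hχ hlim ζ j
  set φ := p.1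
  set z := partialDeriv j ζ with hz
  have hn : Tendsto (fun n : ℕ => (n : ℝ) + 1) atTop atTop :=
    tendsto_natCast_atTop_atTop.atTop_add tendsto_const_nhds
  set F : ℕ → Space N → ℝ := fun n x =>
    logTrunc (Real.exp (-((n : ℝ) + 1))) (φ x) / ((n : ℝ) + 1) * z x with hF
  have hFint : ∀ n : ℕ, ∫ x in (Ω : Set (Space N)), F n x =
      inner ℝ ((lipschitzWith_logTrunc (Real.exp_pos (-((n : ℝ) + 1)))).compLp
        (logTrunc_zero _) φ) (testToL2 Ω ℝ z) / ((n : ℝ) + 1) := by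
    intro n
    rw [inner_testToL2, ← integral_div]
    refine integral_congr_ae ?_
    filter_upwards [(lipschitzWith_logTrunc (Real.exp_pos (-((n : ℝ) + 1)))).coeFn_compLp
      (logTrunc_zero _) φ] with x hx
    rw [hx, hF, Function.comp_apply]
    ring
  -- The constant `C` does not depend on `ε = exp (-(n + 1))`, so dividing by `n + 1` kills the
  -- pairing.
  have hzero : Tendsto (fun n => ∫ x in (Ω : Set (Space N)), F n x) atTop (𝓝 0) := by
    refine squeeze_zero_norm (a := fun n : ℕ => C / ((n : ℝ) + 1)) (fun n => ?_)
      (tendsto_const_nhds.div_atTop hn)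
    have hpos : 0 < (n : ℝ) + 1 := by positivity
    rw [hFint, Real.norm_eq_abs, abs_div, abs_of_pos hpos]
    exact div_le_div_of_nonneg_right (hC _ (Real.exp_pos _)) hpos.le
  have hlimF : Tendsto (fun n => ∫ x in (Ω : Set (Space N)), F n x) atTop
      (𝓝 (∫ x in (Ω : Set (Space N)),
        z x * {x | 0 < φ x}.indicator (fun _ => (1 : ℝ)) x)) := by
    refine tendsto_integral_of_dominated_convergence (fun x => |z x| + ‖z x * φ x‖) ?_ ?_ ?_ ?_
    · intro n
      have h1 : Continuous (logTrunc (Real.exp (-((n : ℝ) + 1)))) :=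
        (lipschitzWith_logTrunc (Real.exp_pos _)).continuous
      have h2 := h1.comp_aestronglyMeasurable (Lp.aestronglyMeasurable φ)
      simp only [hF, div_eq_mul_inv]
      exact (h2.mul_const _).mul z.continuous.aestronglyMeasurable
    · refine Integrable.add ?_ (integrable_testFunction_smul Ω ℝ z φ).norm
      exact (Continuous.integrable_of_hasCompactSupport z.continuous
        z.hasCompactSupport).abs.restrict
    · intro n
      filter_upwards [hφ] with x hx
      rw [hF, norm_mul, norm_mul, Real.norm_eq_abs, Real.norm_eq_abs, Real.norm_of_nonneg hx]
      have := mul_le_mul_of_nonneg_right (abs_logTrunc_exp_neg_div_le (k := (n : ℝ) + 1)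
        (by linarith [Nat.cast_nonneg (α := ℝ) n]) hx) (abs_nonneg (z x))
      linarith
    · filter_upwards [hφ] with x hx
      rw [mul_comm]
      exact (tendsto_logTrunc_exp_neg_div hx).mul_const (z x)
  rw [← setIntegral_eq_integral_of_forall_compl_eq_zero (s := (Ω : Set (Space N)))
    (fun x hx => by rw [testFunction_eq_zero _ hx, zero_mul])]
  exact tendsto_nhds_unique hlimF hzero

/-- The scalar Dirichlet Laplacian on a bounded connected open set has an almost everywhere
positive eigenfunction for the first eigenvalue. -/
theorem exists_pos_eigenfunction (hbdd : Bornology.IsBounded (Ω : Set (Space N)))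
    (hconn : IsConnected (Ω : Set (Space N))) :
    ∃ φ : L2 Ω ℝ, φ ≠ 0 ∧ (φ, firstEigenvalue Ω • φ) ∈ laplacianGraph Ω ℝ ∧
      ∀ᵐ x ∂(volume.restrict (Ω : Set (Space N))), 0 < φ x := by
  obtain ⟨χ, p, hχ, hlim, hnorm, hE⟩ := exists_nonneg_minimizer hbdd hconn.nonempty
  have hp : p ∈ H10 Ω ℝ := isClosed_H10.mem_of_tendsto hlim
    (Eventually.of_forall fun n => testWithGradient_mem_H10 Ω ℝ (χ n))
  have hEL : ∀ q ∈ H10 Ω ℝ, ∑ j, inner ℝ (p.2 j) (q.2 j) = inner ℝ (rayleighInf Ω • p.1) q.1 :=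
    fun q hq => euler_lagrange_of_minimizer hp hnorm hE hq
  have hne : p.1 ≠ 0 := fun h => by simp [h] at hnorm
  have hφ : ∀ᵐ x ∂(volume.restrict (Ω : Set (Space N))), 0 ≤ p.1 x := by
    refine (Lp.coeFn_nonneg p.1).2 (isClosed_nonneg.mem_of_tendsto
      ((continuous_fst.tendsto _).comp hlim) (Eventually.of_forall fun n => ?_))
    refine (Lp.coeFn_nonneg _).1 ?_
    filter_upwards [coeFn_testToL2 (χ n)] with x hx
    exact (hχ n x).trans_eq hx.symm
  refine ⟨p.1, hne, ?_, ?_⟩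
  · rw [rayleighInf_eq_firstEigenvalue hp hnorm hE]
    exact ⟨p.2, hp, hEL⟩
  · have hS : MeasurableSet {x | 0 < p.1 x} :=
      measurableSet_lt measurable_const (Lp.stronglyMeasurable p.1).measurable
    -- Either `φ > 0` a.e., or `{φ > 0}` is null and `φ ≥ 0` forces `φ = 0`.
    rcases measure_diff_eq_zero_or_inter_eq_zero hconn.isPreconnected hS
      (integral_partialDeriv_indicator_eq_zero hbdd rayleighInf_nonneg hEL hφ hχ hlim) with h | h
    · rw [ae_restrict_iff' Ω.isOpen.measurableSet, ae_iff]
      refine measure_mono_null (fun x hx => ?_) h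
      simpa using hx
    · refine absurd ((Lp.eq_zero_iff_ae_eq_zero).2 ?_) hne
      have h' : ∀ᵐ x ∂(volume.restrict (Ω : Set (Space N))), ¬ 0 < p.1 x := by
        rw [ae_restrict_iff' Ω.isOpen.measurableSet, ae_iff]
        refine measure_mono_null (fun x hx => ?_) h
        simpa using hx
      filter_upwards [hφ, h'] with x h1 h2
      exact le_antisymm (not_lt.1 h2) h1

end StrongMaximumPrinciple

end DirichletSystem

theorem mainTheorem9 {N M : ℕ} (hN : 0 < N) (hM : 0 < M)
    (Ω : TopologicalSpace.Opens (EuclideanSpace ℝ (Fin N)))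
    (hbdd : Bornology.IsBounded (Ω : Set (EuclideanSpace ℝ (Fin N))))
    (hconn : IsConnected (Ω : Set (EuclideanSpace ℝ (Fin N))))
    (D : Matrix (Fin M) (Fin M) ℝ) (hD : QuasiNonneg D)
    (hσ : firstEigenvalue Ω ∉ sigmaPlus D) :
    solutions Ω D 0 ∩ cone Ω M = {0} ∧
      (firstEigenvalue Ω < spectralBound D →
        ∃ w ∈ cone Ω M, solutions Ω D w ∩ cone Ω M = ∅) := by
  obtain ⟨φ, hne, hφ, hpos⟩ := exists_pos_eigenfunction hbdd hconn
  exact solutions_inter_cone_of_pos_eigenfunction hM hφ hne hpos hD hσ
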